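/- Let $\varepsilon>4$ be real and $\lambda\in\mathbb C$. Let $\Gamma_\varepsilon=\{(x,y)\in\mathbb C^2:\cos(2\pi x)+\cos(2\pi y)=\varepsilon/2\}$, let $\alpha>0$ be the positive solution of $\varepsilon=2+2\cosh(2\pi\alpha)$, put $P_0=(\mathrm i\alpha,0)\in\Gamma_\varepsilon$, and let $\theta_\lambda$ be the holomorphic 1-form on $\Gamma_\varepsilon$ given by $\theta_\lambda=\bigl(x+\frac{\lambda}{\sin(2\pi x)}\bigr)\,dy$, where $\frac{dy}{\sin(2\pi x)}$ is read as $-\frac{dx}{\sin(2\pi y)}$ at points with $\sin(2\pi x)=0$. Paths are piecewise $C^1$ paths on $\Gamma_\varepsilon$. Assume the spectral equations: $e^{2\pi \mathrm i\int_\gamma\theta_\lambda}=1$ for every path $\gamma$ on $\Gamma_\varepsilon$ starting at $P_0$ whose images under $(x,y)\mapsto x$ and under $(x,y)\mapsto(e^{2\pi \mathrm ix},e^{2\pi \mathrm iy})$ are closed paths. Then the following hold. (1) There is an entire function $\varphi:\mathbb C\to\mathbb C$ such that, for every $(x,y)\in\Gamma_\varepsilon$ and every path $\gamma$ on $\Gamma_\varepsilon$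 from $P_0$ to $(x,y)$, $$\sin(2\pi y)\,\varphi(x)=\sin\Bigl(2\pi\int_\gamma\theta_\lambda\Bigr).$$ This $\varphi$ satisfies $\varphi(x-1)+\varphi(x+1)+(2\cos(2\pi x)-\varepsilon)\varphi(x)=0$ for all $x\in\mathbb C$. Moreover $\psi(z)=\varphi(\mathrm iz)$ is an eigenfunction with eigenvalue $\varepsilon$ of the corresponding ($\mathsf b=1$) problem: $\psi$ is entire, does not vanish identically on $\mathbb R$, is square integrable on every line $\mathbb R+\mathrm it$ with $-1<t<1$ (in particular on $\mathbb R$), and satisfies $\psi(x-\mathrm i)+\psi(x+\mathrm i)=(\varepsilon-2\cosh(2\pi x))\psi(x)$ for all $x\in\mathbb R$. (2) Let $r(t)\ge 0$ and $s(t)$ be the real functions with $\cosh(2\pi r(t))=1-\cos(\pi t)+\cosh(2\pi\alpha)$ and $\sinh(\pi s(t))=\sinh(\pi\alpha)\sin(\pi t)$, and put $$A=4\int_0^{1/2}\frac{s'(t)\,dt}{\sinh(2\pi s(t+\frac12))},\quad \tilde A=4\int_0^{1/2}s(t+\tfrac12)s'(t)\,dt,\quad B=\int_0^1\frac{dt}{\sinh(2\pi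 r(t))},\quad \tilde B=\int_0^1 r(t)\,dt .$$ Then the quantization conditions hold: $A\lambda-\tilde A=n+1$ for some integer $n\ge0$, and $\mathrm i(\tilde B-\lambda B)\in\mathbb Z$; in fact $\lambda=\tilde B/B$, so that $A\tilde B-B\tilde A=(n+1)B$. -/

import Mathlib

noncomputable section

namespace Harper

/-! ### The spectral curve and the deformed symplectic potential -/

/-- The spectral curve `cos (2πx) + cos (2πy) = ε / 2` in `ℂ²`. -/
def spectralCurve (ε : ℝ) : Set (ℂ × ℂ) :=
  {p | Complex.cos (2 * Real.pi * p.1) + Complex.cos (2 * Real.pi * p.2) = (ε : ℂ) / 2}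

/-- The map `(x, y) ↦ (exp (2πix), exp (2πiy))` to the elliptic curve. -/
def expMap (p : ℂ × ℂ) : ℂ × ℂ :=
  (Complex.exp (2 * Real.pi * Complex.I * p.1), Complex.exp (2 * Real.pi * Complex.I * p.2))

/-- The form `x dy + lam * dy / sin (2πx)`. On the spectral curve one has
`dy / sin (2πx) = - dx / sin (2πy)`, and the right-hand side is used at the points where
`sin (2πx) = 0` (for `ε > 4` one then has `sin (2πy) ≠ 0` there), so that the restriction to
tangent vectors of the curve is the holomorphic form. -/
def theta (lam : ℂ) (p : ℂ × ℂ) : ℂ × ℂ →L[ℂ] ℂ :=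
  p.1 • ContinuousLinearMap.snd ℂ ℂ ℂ +
    lam • (if Complex.sin (2 * Real.pi * p.1) = 0 then
        (-(Complex.sin (2 * Real.pi * p.2))⁻¹) • ContinuousLinearMap.fst ℂ ℂ ℂ
      else (Complex.sin (2 * Real.pi * p.1))⁻¹ • ContinuousLinearMap.snd ℂ ℂ ℂ)

/-- Piecewise `C¹` paths: there is a finite set of times such that the path is `C¹` on every
closed subinterval of `[0, 1]` with none of these times in its interior. -/
def IsPiecewiseC1 {P Q : ℂ × ℂ} (γ : Path P Q) : Prop :=
  ∃ S : Finset ℝ, ∀ a b : ℝ, 0 ≤ a → a < b → b ≤ 1 → (∀ s ∈ S, s ∉ Set.Ioo a b) →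
    ContDiffOn ℝ 1 γ.extend (Set.Icc a b)

/-- Piecewise `C¹` paths that stay on the spectral curve. -/
def IsCurvePath (ε : ℝ) {P Q : ℂ × ℂ} (γ : Path P Q) : Prop :=
  IsPiecewiseC1 γ ∧ ∀ t, γ t ∈ spectralCurve ε

/-- The spectral equations with base point `P`: `exp (2πi ∫_γ θ) = 1` for every path `γ` from `P`
on the spectral curve whose images under `(x, y) ↦ x` and under `expMap` are closed. -/
def SpectralEquations (lam : ℂ) (ε : ℝ) (P : ℂ × ℂ) : Prop :=
  ∀ (Q : ℂ × ℂ) (γ : Path P Q), IsCurvePath ε γ → Q.1 = P.1 → expMap Q = expMap P →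
    Complex.exp (2 * Real.pi * Complex.I * curveIntegral (theta lam) γ) = 1

/-- The positive solution `α` of `ε = 2 + 2 cosh (2πα)`, for `ε > 4`. -/
def alpha (ε : ℝ) : ℝ := Real.arcosh (ε / 2 - 1) / (2 * Real.pi)

lemma alpha_pos {ε : ℝ} (hε : 4 < ε) : 0 < alpha ε :=
  div_pos (Real.arcosh_pos (by linarith)) (by positivity)

lemma alpha_spec {ε : ℝ} (hε : 4 < ε) : ε = 2 + 2 * Real.cosh (2 * Real.pi * alpha ε) := by
  have h : 2 * Real.pi * alpha ε = Real.arcosh (ε / 2 - 1) := by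
    unfold alpha
    field_simp
  rw [h, Real.cosh_arcosh (by linarith)]
  ring

/-- The branch point `(iα, 0)`. -/
def basePoint (ε : ℝ) : ℂ × ℂ := (Complex.I * alpha ε, 0)

/-! ### The period integrals -/

/-- The function `r` with `cosh (2π r(t)) = 1 - cos (πt) + cosh (2πα)` and `r ≥ 0`. -/
def rFun (ε t : ℝ) : ℝ :=
  Real.arcosh (1 - Real.cos (Real.pi * t) + Real.cosh (2 * Real.pi * alpha ε)) / (2 * Real.pi)

/-- The function `s` with `sinh (π s(t)) = sinh (πα) sin (πt)`. -/
def sFun (ε t : ℝ) : ℝ :=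
  Real.arsinh (Real.sinh (Real.pi * alpha ε) * Real.sin (Real.pi * t)) / Real.pi

def perA (ε : ℝ) : ℝ :=
  4 * ∫ t in (0 : ℝ)..(1 / 2),
    deriv (sFun ε) t / Real.sinh (2 * Real.pi * sFun ε (t + 1 / 2))

def perAtilde (ε : ℝ) : ℝ :=
  4 * ∫ t in (0 : ℝ)..(1 / 2), sFun ε (t + 1 / 2) * deriv (sFun ε) t

def perB (ε : ℝ) : ℝ :=
  ∫ t in (0 : ℝ)..1, 1 / Real.sinh (2 * Real.pi * rFun ε t)

def perBtilde (ε : ℝ) : ℝ :=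
  ∫ t in (0 : ℝ)..1, rFun ε t

/-! ### Eigenfunctions -/

/-- `ψ` is an eigenfunction, with eigenvalue `ε`, of the operator with the difference expression
`ψ(x - i) + ψ(x + i) + 2 cosh (2πx) ψ(x)`: it is analytic on the strip `|Im z| < 1`, continuous
on its closure, square integrable on every horizontal line inside the strip, not identically zero
on the real line, and it satisfies the eigenvalue equation there. -/
structure IsEigenfunction (ε : ℝ) (ψ : ℂ → ℂ) : Prop where
  diffContOnCl : DiffContOnCl ℂ ψ {z : ℂ | |z.im| < 1}
  memLp : ∀ t : ℝ, |t| < 1 →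
    MeasureTheory.MemLp (fun x : ℝ => ψ (x + t * Complex.I)) 2 MeasureTheory.volume
  ne_zero : ∃ x : ℝ, ψ x ≠ 0
  equation : ∀ x : ℝ, ψ (x - Complex.I) + ψ (x + Complex.I) =
    (ε - 2 * Complex.cosh (2 * Real.pi * x)) * ψ x

end Harper

end

namespace Harper

open Set MeasureTheory Filter Topology
open scoped ComplexConjugate

/-! ### Piecewise smooth paths on the spectral curve -/

/-! Call `w = ∫ θ` along a path from `P₀` to `(x, y)` an action value. The spectral equations for
loops at `P₀` say that `w` is determined modulo `ℤ`. Two explicit paths are then evaluated. The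
closed oval with imaginary coordinates has integral `Aλ - Ã`, which must be an integer, so `λ` is
real. The path with real `y` from `P₀` to `P₀ + (0, 1)` has integral `i(B̃ - λB)`, which is
therefore both imaginary and an integer, hence zero. So `λ = B̃ / B`. That `Aλ - Ã` is a positive
integer follows from `Ã / A < α sinh (2πα) ≤ B̃ / B`, a pointwise comparison of integrands.

The symmetries of the curve act on action values: `y ↦ -y` gives `-w`, `y ↦ y + 1` keeps `w` (this
is `B̃ = λB`), and `x ↦ x + 1` gives `w + y`. The points over a fixed `x` are `±y + k`, so `sin
(2πw) / sin (2πy)` depends on `x` only (`exists_descend`). Where `sin (2πy) = 0` one has `2y ∈ ℤ`,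
the reflected point is the point itself up to translation, and so `2w ∈ ℤ`. The numerator vanishes
too, the quotient stays bounded, and `φ` is entire by Riemann's theorem. The difference equation is
`sin (2π(w + y)) + sin (2π(w - y)) = 2 cos (2πy) sin (2πw)` with `2 cos (2πy) = ε - 2 cos (2πx)`.

For `x = t + iX` with `X → ∞`, `|sin (2πy)|` is at least a multiple of `exp (2πX)`, while `dw/dx =
-(x sin (2πx) + λ) / sin (2πy)` is close to `±x`. Hence `|Im w|` grows at most like `|t| X`, and
`|φ|²` is `O(exp (-4π(1 - |t|)X))`. The reflection `x ↦ -x` covers `X → -∞`. Finally `φ` is not zero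
on the imaginary axis, since `dw/dx = -λ / sin (2πy) ≠ 0` at `x = 0`.

No covering space or homotopy is used: the relation `IsIntegralValue` is closed under reversal,
concatenation and the symmetries, and this suffices. -/

theorem mem_spectralCurve {ε : ℝ} {p : ℂ × ℂ} : p ∈ spectralCurve ε ↔
    Complex.cos (2 * Real.pi * p.1) + Complex.cos (2 * Real.pi * p.2) = (ε : ℂ) / 2 := Iff.rfl

/-- The two partial derivatives of the equation of the curve do not vanish simultaneously. -/
theorem sin_ne_zero_of_sin_eq_zero {ε : ℝ} (hε : 4 < ε) {x y : ℂ}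
    (h : Complex.cos x + Complex.cos y = (ε : ℂ) / 2) (hx : Complex.sin x = 0) :
    Complex.sin y ≠ 0 := by
  intro hy
  have h1 : Complex.cos x = 1 ∨ Complex.cos x = -1 := by
    have := Complex.sin_sq_add_cos_sq x
    rw [hx] at this
    exact mul_self_eq_one_iff.1 (by simpa [sq] using this)
  have h2 : Complex.cos y = 1 ∨ Complex.cos y = -1 := by
    have := Complex.sin_sq_add_cos_sq y
    rw [hy] at this
    exact mul_self_eq_one_iff.1 (by simpa [sq] using this)
  rcases h1 with h1 | h1 <;> rcases h2 with h2 | h2 <;> rw [h1, h2] at h <;>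
    (have := congrArg Complex.re h; simp at this; linarith)

/-- Split an interval at a break point in its interior and use strong induction on the number of
interior break points. -/
theorem IsPiecewiseC1.induction {p q : ℂ × ℂ} {γ : Path p q} (hγ : IsPiecewiseC1 γ)
    {C : ℝ → ℝ → Prop}
    (smooth : ∀ a b, 0 ≤ a → a < b → b ≤ 1 → ContDiffOn ℝ 1 γ.extend (Icc a b) → C a b)
    (trans : ∀ a b c, a < b → b < c → C a b → C b c → C a c) : C 0 1 := by
  classical
  obtain ⟨S, hS⟩ := hγ
  have key : ∀ n : ℕ, ∀ a b : ℝ, 0 ≤ a → a < b → b ≤ 1 →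
      (S.filter (· ∈ Ioo a b)).card = n → C a b := by
    intro n
    induction n using Nat.strong_induction_on with
    | _ n ih =>
      intro a b ha hab hb hn
      by_cases h : ∀ s ∈ S, s ∉ Ioo a b
      · exact smooth a b ha hab hb (hS a b ha hab hb h)
      · push Not at h
        obtain ⟨s, hs, hsab⟩ := h
        refine trans a s b hsab.1 hsab.2
          (ih _ ?_ a s ha hsab.1 (hsab.2.le.trans hb) rfl)
          (ih _ ?_ s b (ha.trans hsab.1.le) hsab.2 hb rfl)
        · rw [← hn]
          refine Finset.card_lt_card (Finset.ssubset_iff_of_subset ?_ |>.2 ⟨s, ?_, ?_⟩)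
          · intro u hu
            simp only [Finset.mem_filter, mem_Ioo] at hu ⊢
            exact ⟨hu.1, hu.2.1, hu.2.2.trans hsab.2⟩
          · simpa using ⟨hs, hsab⟩
          · simp
        · rw [← hn]
          refine Finset.card_lt_card (Finset.ssubset_iff_of_subset ?_ |>.2 ⟨s, ?_, ?_⟩)
          · intro u hu
            simp only [Finset.mem_filter, mem_Ioo] at hu ⊢
            exact ⟨hu.1, hsab.1.trans hu.2.1, hu.2.2⟩
          · simpa using ⟨hs, hsab⟩
          · simp
  exact key _ 0 1 le_rfl one_pos le_rfl rfl

theorem IsPiecewiseC1.exists_differentiableAt {p q : ℂ × ℂ} {γ : Path p q}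
    (hγ : IsPiecewiseC1 γ) :
    ∃ S : Set ℝ, S.Finite ∧ ∀ t ∈ Ioo (0 : ℝ) 1 \ S, DifferentiableAt ℝ γ.extend t := by
  obtain ⟨S, hS⟩ := hγ
  refine ⟨S, S.finite_toSet, fun t ht => ?_⟩
  have hopen : IsOpen (Ioo (0 : ℝ) 1 \ S) := isOpen_Ioo.sdiff S.finite_toSet.isClosed
  obtain ⟨δ, hδ, hb⟩ := Metric.isOpen_iff.1 hopen t ht
  have hsub : Icc (t - δ / 2) (t + δ / 2) ⊆ Ioo (0 : ℝ) 1 \ S := by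
    refine Subset.trans (fun u hu => ?_) hb
    rw [Metric.mem_ball, Real.dist_eq, abs_lt]
    constructor <;> linarith [hu.1, hu.2]
  have h0 := hsub (left_mem_Icc.2 (by linarith))
  have h1 := hsub (right_mem_Icc.2 (by linarith))
  have := hS (t - δ / 2) (t + δ / 2) h0.1.1.le (by linarith) h1.1.2.le
    (fun s hs hs' => (hsub (Ioo_subset_Icc_self hs')).2 hs)
  exact (this.contDiffAt (Icc_mem_nhds (by linarith) (by linarith))).differentiableAt one_ne_zero

theorem IsPiecewiseC1.symm {p q : ℂ × ℂ} {γ : Path p q} (hγ : IsPiecewiseC1 γ) :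
    IsPiecewiseC1 γ.symm := by
  classical
  obtain ⟨S, hS⟩ := hγ
  refine ⟨S.image (fun s => 1 - s), fun a b ha hab hb h => ?_⟩
  rw [Path.extend_symm]
  refine (hS (1 - b) (1 - a) (by linarith) (by linarith) (by linarith) ?_).comp
    (by fun_prop) (fun t ht => ⟨by linarith [ht.2], by linarith [ht.1]⟩)
  intro s hs hs'
  exact h (1 - s) (Finset.mem_image_of_mem _ hs) ⟨by linarith [hs'.2], by linarith [hs'.1]⟩

theorem IsPiecewiseC1.trans {p q r : ℂ × ℂ} {γ : Path p q} {γ' : Path q r}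
    (hγ : IsPiecewiseC1 γ) (hγ' : IsPiecewiseC1 γ') : IsPiecewiseC1 (γ.trans γ') := by
  classical
  obtain ⟨S, hS⟩ := hγ
  obtain ⟨S', hS'⟩ := hγ'
  refine ⟨insert (1 / 2) (S.image (fun s => s / 2) ∪ S'.image (fun s => (s + 1) / 2)),
    fun a b ha hab hb h => ?_⟩
  have hhalf := h (1 / 2) (by simp)
  by_cases hb2 : b ≤ 1 / 2
  · refine ContDiffOn.congr (f := fun t => γ.extend (2 * t)) ?_
      (fun t ht => Path.extend_trans_of_le_half _ _ (ht.2.trans hb2))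
    refine (hS (2 * a) (2 * b) (by linarith) (by linarith) (by linarith) ?_).comp
      (by fun_prop) (fun t ht => ⟨by linarith [ht.1], by linarith [ht.2]⟩)
    intro s hs hs'
    refine h (s / 2) ?_ ⟨by linarith [hs'.1], by linarith [hs'.2]⟩
    simp only [Finset.mem_insert, Finset.mem_union, Finset.mem_image]
    exact Or.inr (Or.inl ⟨s, hs, rfl⟩)
  · have ha2 : 1 / 2 ≤ a := by
      by_contra hcon
      exact hhalf ⟨by linarith, by linarith⟩
    refine ContDiffOn.congr (f := fun t => γ'.extend (2 * t - 1)) ?_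
      (fun t ht => Path.extend_trans_of_half_le _ _ (ha2.trans ht.1))
    refine (hS' (2 * a - 1) (2 * b - 1) (by linarith) (by linarith) (by linarith) ?_).comp
      (by fun_prop) (fun t ht => ⟨by linarith [ht.1], by linarith [ht.2]⟩)
    intro s hs hs'
    refine h ((s + 1) / 2) ?_ ⟨by linarith [hs'.1], by linarith [hs'.2]⟩
    simp only [Finset.mem_insert, Finset.mem_union, Finset.mem_image]
    exact Or.inr (Or.inr ⟨s, hs, rfl⟩)

theorem IsCurvePath.symm {ε : ℝ} {p q : ℂ × ℂ} {γ : Path p q} (hγ : IsCurvePath ε γ) :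
    IsCurvePath ε γ.symm :=
  ⟨hγ.1.symm, fun _ => hγ.2 _⟩

theorem IsCurvePath.trans {ε : ℝ} {p q r : ℂ × ℂ} {γ : Path p q} {γ' : Path q r}
    (hγ : IsCurvePath ε γ) (hγ' : IsCurvePath ε γ') : IsCurvePath ε (γ.trans γ') := by
  refine ⟨hγ.1.trans hγ'.1, fun t => ?_⟩
  rw [Path.trans_apply]
  split_ifs
  · exact hγ.2 _
  · exact hγ'.2 _

theorem IsCurvePath.extend_mem {ε : ℝ} {p q : ℂ × ℂ} {γ : Path p q} (hγ : IsCurvePath ε γ)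
    (t : ℝ) : γ.extend t ∈ spectralCurve ε :=
  hγ.2 _

/-! ### The form along tangent vectors -/

/-- The equation of tangent vectors to the curve. -/
def IsTangent (p v : ℂ × ℂ) : Prop :=
  Complex.sin (2 * Real.pi * p.1) * v.1 + Complex.sin (2 * Real.pi * p.2) * v.2 = 0

theorem isTangent_of_hasDerivAt {ε : ℝ} {f : ℝ → ℂ × ℂ} {v : ℂ × ℂ} {t : ℝ}
    (hf : ∀ᶠ s in 𝓝 t, f s ∈ spectralCurve ε) (h : HasDerivAt f v t) :
    IsTangent (f t) v := by
  have h1 : HasDerivAt (fun s => (f s).1) v.1 t :=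
    (hasFDerivAt_fst (𝕜 := ℝ) (E := ℂ) (F := ℂ) (p := f t)).comp_hasDerivAt t h
  have h2 : HasDerivAt (fun s => (f s).2) v.2 t :=
    (hasFDerivAt_snd (𝕜 := ℝ) (E := ℂ) (F := ℂ) (p := f t)).comp_hasDerivAt t h
  have h3 := ((Complex.hasDerivAt_cos _).comp t (h1.const_mul (2 * Real.pi : ℂ))).add
    ((Complex.hasDerivAt_cos _).comp t (h2.const_mul (2 * Real.pi : ℂ)))
  have h4 : HasDerivAt (fun _ : ℝ => (ε : ℂ) / 2) 0 t := hasDerivAt_const _ _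
  have h5 := h3.unique (h4.congr_of_eventuallyEq (hf.mono fun s hs => hs))
  have hpi : (2 * Real.pi : ℂ) ≠ 0 := by
    simp [Real.pi_ne_zero]
  unfold IsTangent
  apply mul_left_cancel₀ hpi
  linear_combination -h5

/-- A version of `theta` that is continuous near the spectral curve and agrees with it on tangent
vectors. -/
noncomputable def thetaReg (lam : ℂ) (p v : ℂ × ℂ) : ℂ :=
  p.1 * v.2 + lam * ((conj (Complex.sin (2 * Real.pi * p.1)) * v.2 -
    conj (Complex.sin (2 * Real.pi * p.2)) * v.1) /
    (conj (Complex.sin (2 * Real.pi * p.1)) * Complex.sin (2 * Real.pi * p.1) +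
      conj (Complex.sin (2 * Real.pi * p.2)) * Complex.sin (2 * Real.pi * p.2)))

theorem thetaReg_den_ne_zero {ε : ℝ} (hε : 4 < ε) {p : ℂ × ℂ} (hp : p ∈ spectralCurve ε) :
    conj (Complex.sin (2 * Real.pi * p.1)) * Complex.sin (2 * Real.pi * p.1) +
      conj (Complex.sin (2 * Real.pi * p.2)) * Complex.sin (2 * Real.pi * p.2) ≠ 0 := by
  rw [← Complex.normSq_eq_conj_mul_self, ← Complex.normSq_eq_conj_mul_self, ← Complex.ofReal_add,
    Complex.ofReal_ne_zero]
  by_cases h : Complex.sin (2 * Real.pi * p.1) = 0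
  · have := Complex.normSq_pos.2 (sin_ne_zero_of_sin_eq_zero hε hp h)
    have := Complex.normSq_nonneg (Complex.sin (2 * Real.pi * p.1))
    positivity
  · have := Complex.normSq_pos.2 h
    have := Complex.normSq_nonneg (Complex.sin (2 * Real.pi * p.2))
    positivity

theorem theta_apply_of_ne {lam : ℂ} {p v : ℂ × ℂ} (h : Complex.sin (2 * Real.pi * p.1) ≠ 0) :
    theta lam p v = p.1 * v.2 + lam * (v.2 / Complex.sin (2 * Real.pi * p.1)) := by
  simp [theta, h, div_eq_inv_mul]

theorem theta_apply_of_eq {lam : ℂ} {p v : ℂ × ℂ} (h : Complex.sin (2 * Real.pi * p.1) = 0) :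
    theta lam p v = p.1 * v.2 - lam * (v.1 / Complex.sin (2 * Real.pi * p.2)) := by
  simp [theta, h, div_eq_inv_mul, sub_eq_add_neg]

/-- The quotient in `thetaReg` is the mean of `v.2 / sin (2πx)` and `-v.1 / sin (2πy)` with weights
`|sin (2πx)|²` and `|sin (2πy)|²`. On tangent vectors the two agree wherever both are defined. -/
theorem theta_apply_of_isTangent {ε : ℝ} (hε : 4 < ε) (lam : ℂ) {p v : ℂ × ℂ}
    (hp : p ∈ spectralCurve ε) (hv : IsTangent p v) : theta lam p v = thetaReg lam p v := by
  have hden := thetaReg_den_ne_zero hε hp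
  unfold IsTangent at hv
  unfold thetaReg
  by_cases h : Complex.sin (2 * Real.pi * p.1) = 0
  · have h2 := sin_ne_zero_of_sin_eq_zero hε hp h
    rw [theta_apply_of_eq h]
    rw [h] at hv hden ⊢
    have hv2 : v.2 = 0 := by simpa [h2] using hv
    rw [hv2]
    rw [mul_zero, zero_add] at hden
    have h3 := left_ne_zero_of_mul hden
    simp only [map_zero, zero_add, mul_zero, zero_sub]
    field_simp
  · rw [theta_apply_of_ne h]
    congr 2
    rw [div_eq_div_iff h hden]
    linear_combination conj (Complex.sin (2 * Real.pi * p.2)) * hv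

theorem theta_apply_snd_ne (lam : ℂ) {p v : ℂ × ℂ} (hv : IsTangent p v)
    (h : Complex.sin (2 * Real.pi * p.2) ≠ 0) :
    theta lam p v = p.1 * v.2 - lam * (v.1 / Complex.sin (2 * Real.pi * p.2)) := by
  by_cases h1 : Complex.sin (2 * Real.pi * p.1) = 0
  · exact theta_apply_of_eq h1
  · rw [theta_apply_of_ne h1]
    unfold IsTangent at hv
    have : v.2 / Complex.sin (2 * Real.pi * p.1) = - (v.1 / Complex.sin (2 * Real.pi * p.2)) := by
      rw [← neg_div, div_eq_div_iff h1 h]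
      linear_combination hv
    rw [this]
    ring

/-- The case split in `theta` is discontinuous as a functional, so continuity of the integrand on
each smooth piece is taken from `thetaReg`. -/
theorem IsCurvePath.curveIntegrable {ε : ℝ} (hε : 4 < ε) (lam : ℂ) {p q : ℂ × ℂ} {γ : Path p q}
    (hγ : IsCurvePath ε γ) : CurveIntegrable (theta lam) γ := by
  refine hγ.1.induction (C := fun a b => IntervalIntegrable (curveIntegralFun (theta lam) γ)
    volume a b) ?_ (fun a b c _ _ h1 h2 => h1.trans h2)
  intro a b ha hab hb hsm
  have hd : ContinuousOn (derivWithin γ.extend (Icc a b)) (Icc a b) :=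
    hsm.continuousOn_derivWithin (uniqueDiffOn_Icc hab) le_rfl
  have hc : ContinuousOn (fun t => thetaReg lam (γ.extend t)
      (derivWithin γ.extend (Icc a b) t)) (Icc a b) := by
    have h0 : Continuous γ.extend := γ.extend.continuous
    unfold thetaReg
    have hc1 : Continuous fun t => conj (Complex.sin (2 * Real.pi * (γ.extend t).1)) := by fun_prop
    have hc2 : Continuous fun t => conj (Complex.sin (2 * Real.pi * (γ.extend t).2)) := by fun_prop
    have hc3 : Continuous fun t => Complex.sin (2 * Real.pi * (γ.extend t).1) := by fun_prop
    have hc4 : Continuous fun t => Complex.sin (2 * Real.pi * (γ.extend t).2) := by fun_prop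
    have hc5 : Continuous fun t => (γ.extend t).1 := by fun_prop
    refine (hc5.continuousOn.mul hd.snd).add (continuousOn_const.mul (ContinuousOn.div ?_ ?_ ?_))
    · exact (hc1.continuousOn.mul hd.snd).sub (hc2.continuousOn.mul hd.fst)
    · exact ((hc1.mul hc3).add (hc2.mul hc4)).continuousOn
    · exact fun t _ => thetaReg_den_ne_zero hε (hγ.extend_mem t)
  refine (hc.intervalIntegrable_of_Icc hab.le).congr_ae ?_
  rw [uIoc_of_le hab.le, ← restrict_Ioo_eq_restrict_Ioc]
  filter_upwards [ae_restrict_mem measurableSet_Ioo] with t ht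
  have hmem : Icc a b ∈ 𝓝 t := Icc_mem_nhds ht.1 ht.2
  have hda : DifferentiableAt ℝ γ.extend t :=
    (hsm.contDiffAt hmem).differentiableAt one_ne_zero
  rw [curveIntegralFun_def, hda.derivWithin (uniqueDiffOn_Icc hab t (Ioo_subset_Icc_self ht)),
    hda.derivWithin (uniqueDiffOn_Icc_zero_one t ⟨ha.trans ht.1.le, ht.2.le.trans hb⟩)]
  exact (theta_apply_of_isTangent hε lam (hγ.extend_mem t) (isTangent_of_hasDerivAt
    (Eventually.of_forall hγ.extend_mem) hda.hasDerivAt)).symm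

/-! ### Values of the integral between two points -/

/-- `w` is the integral of `theta lam` along some path on the curve from `p` to `q`. -/
def IsIntegralValue (lam : ℂ) (ε : ℝ) (p q : ℂ × ℂ) (w : ℂ) : Prop :=
  ∃ γ : Path p q, IsCurvePath ε γ ∧ curveIntegral (theta lam) γ = w

namespace IsIntegralValue

variable {lam : ℂ} {ε : ℝ} {p q r : ℂ × ℂ} {w w' : ℂ}

theorem symm (h : IsIntegralValue lam ε p q w) : IsIntegralValue lam ε q p (-w) := by
  obtain ⟨γ, hγ, rfl⟩ := h
  exact ⟨γ.symm, hγ.symm, curveIntegral_symm _ _⟩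

theorem trans (hε : 4 < ε) (h : IsIntegralValue lam ε p q w) (h' : IsIntegralValue lam ε q r w') :
    IsIntegralValue lam ε p r (w + w') := by
  obtain ⟨γ, hγ, rfl⟩ := h
  obtain ⟨γ', hγ', rfl⟩ := h'
  exact ⟨γ.trans γ', hγ.trans hγ',
    curveIntegral_trans (hγ.curveIntegrable hε lam) (hγ'.curveIntegrable hε lam)⟩

theorem target_mem (h : IsIntegralValue lam ε p q w) : q ∈ spectralCurve ε := by
  obtain ⟨γ, hγ, rfl⟩ := h
  simpa using hγ.2 1

theorem source_mem (h : IsIntegralValue lam ε p q w) : p ∈ spectralCurve ε :=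
  h.symm.target_mem

/-- The integral along the image of a path under a map of the curve that changes the form by a sign
and an exact form. -/
theorem map (hε : 4 < ε) (h : IsIntegralValue lam ε p q w) {M : ℂ × ℂ → ℂ × ℂ}
    {M' : ℂ × ℂ → ℂ × ℂ →L[ℂ] ℂ × ℂ} {g : ℂ × ℂ → ℂ} {g' : ℂ × ℂ → ℂ × ℂ →L[ℂ] ℂ} (s : ℂ)
    (hM : ContDiff ℂ 1 M) (hM' : ∀ u, HasFDerivAt M (M' u) u) (hg : ∀ u, HasFDerivAt g (g' u) u)
    (hMε : ∀ u ∈ spectralCurve ε, M u ∈ spectralCurve ε)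
    (hθ : ∀ u ∈ spectralCurve ε, ∀ v, IsTangent u v →
      theta lam (M u) (M' u v) = s * theta lam u v + g' u v) :
    IsIntegralValue lam ε (M p) (M q) (s * w + (g q - g p)) := by
  obtain ⟨γ, hγ, rfl⟩ := h
  have hext : (γ.map hM.continuous).extend = M ∘ γ.extend := by
    ext1 t
    rfl
  have hcurve : IsCurvePath ε (γ.map hM.continuous) := by
    refine ⟨?_, fun t => hMε _ (hγ.2 t)⟩
    obtain ⟨S, hS⟩ := hγ.1
    refine ⟨S, fun a b ha hab hb h => ?_⟩
    rw [hext]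
    exact (hM.restrict_scalars ℝ).comp_contDiffOn (hS a b ha hab hb h)
  refine ⟨γ.map hM.continuous, hcurve, ?_⟩
  have hi1 := hcurve.curveIntegrable hε lam
  have hi2 := hγ.curveIntegrable hε lam
  obtain ⟨S, hSfin, hS⟩ := hγ.1.exists_differentiableAt
  have hgc : Continuous g := continuous_iff_continuousAt.2 fun u => (hg u).continuousAt
  -- Away from the finitely many break points, the integrand of the image path minus `s` times the
  -- original one is the derivative of `g ∘ γ`.
  have hFTC := integral_eq_of_hasDerivAt_off_countable (g ∘ γ.extend)
    (fun t => curveIntegralFun (theta lam) (γ.map hM.continuous) t -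
      s * curveIntegralFun (theta lam) γ t) (a := 0) (b := 1) hSfin.countable
    (hgc.comp γ.extend.continuous).continuousOn
    (fun t ht => by
      rw [min_eq_left zero_le_one, max_eq_right zero_le_one] at ht
      have hd := (hS t ht).hasDerivAt
      have hI : t ∈ Icc (0 : ℝ) 1 := Ioo_subset_Icc_self ht.1
      have hMd : HasDerivAt (γ.map hM.continuous).extend
          (M' (γ.extend t) (deriv γ.extend t)) t := by
        rw [hext]
        exact ((hM' _).restrictScalars ℝ).comp_hasDerivAt t hd
      rw [curveIntegralFun_def, curveIntegralFun_def,
        hMd.hasDerivWithinAt.derivWithin (uniqueDiffOn_Icc_zero_one t hI),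
        hd.hasDerivWithinAt.derivWithin (uniqueDiffOn_Icc_zero_one t hI), hext,
        Function.comp_apply, hθ _ (hγ.extend_mem t) _ (isTangent_of_hasDerivAt
          (Eventually.of_forall hγ.extend_mem) hd), add_sub_cancel_left]
      exact ((hg _).restrictScalars ℝ).comp_hasDerivAt t hd)
    (IntervalIntegrable.sub hi1 (hi2.const_mul s))
  rw [intervalIntegral.integral_sub hi1 (hi2.const_mul s), intervalIntegral.integral_const_mul]
    at hFTC
  rw [curveIntegral_def, curveIntegral_def]
  simp only [Function.comp_apply, Path.extend_one, Path.extend_zero] at hFTC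
  linear_combination hFTC

end IsIntegralValue

/-- The integral along a smooth path. -/
theorem isIntegralValue_of_contDiffOn {lam : ℂ} {ε : ℝ} {f : ℝ → ℂ × ℂ}
    (hf : ContDiffOn ℝ 1 f (Icc 0 1)) (hmem : ∀ t ∈ Icc (0 : ℝ) 1, f t ∈ spectralCurve ε) :
    IsIntegralValue lam ε (f 0) (f 1) (∫ t in (0 : ℝ)..1, theta lam (f t) (deriv f t)) := by
  let γ : Path (f 0) (f 1) :=
    { toFun := fun t => f t
      continuous_toFun := hf.continuousOn.comp_continuous continuous_subtype_val (fun t => t.2)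
      source' := by simp
      target' := by simp }
  have hext : EqOn γ.extend f (Icc 0 1) := fun t ht => by
    rw [Path.extend_apply γ ht]
    rfl
  refine ⟨γ, ⟨⟨∅, fun a b ha hab hb _ => ?_⟩, fun t => hmem t t.2⟩, ?_⟩
  · have hsub : Icc a b ⊆ Icc 0 1 := Icc_subset_Icc ha hb
    exact (hf.mono hsub).congr fun t ht => hext (hsub ht)
  · rw [curveIntegral_eq_intervalIntegral_deriv, intervalIntegral.integral_of_le zero_le_one,
      intervalIntegral.integral_of_le zero_le_one, ← restrict_Ioo_eq_restrict_Ioc]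
    refine setIntegral_congr_fun measurableSet_Ioo fun t ht => ?_
    have : γ.extend =ᶠ[𝓝 t] f := eventually_of_mem (Ioo_mem_nhds ht.1 ht.2)
      fun u hu => hext (Ioo_subset_Icc_self hu)
    rw [this.deriv_eq, this.eq_of_nhds]

/-! ### Symmetries of the curve -/

theorem cos_two_pi_mul_add_one (z : ℂ) :
    Complex.cos (2 * Real.pi * (z + 1)) = Complex.cos (2 * Real.pi * z) := by
  rw [mul_add, mul_one, Complex.cos_add_two_pi]

theorem sin_two_pi_mul_add_one (z : ℂ) :
    Complex.sin (2 * Real.pi * (z + 1)) = Complex.sin (2 * Real.pi * z) := by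
  rw [mul_add, mul_one, Complex.sin_add_two_pi]

namespace IsIntegralValue

variable {lam : ℂ} {ε : ℝ} {x y x' y' w : ℂ}

theorem neg_snd (hε : 4 < ε) (h : IsIntegralValue lam ε (x, y) (x', y') w) :
    IsIntegralValue lam ε (x, -y) (x', -y') (-w) := by
  have := h.map hε (M := fun u => (u.1, -u.2))
    (M' := fun _ => (ContinuousLinearMap.fst ℂ ℂ ℂ).prod (-ContinuousLinearMap.snd ℂ ℂ ℂ))
    (g := fun _ => 0) (g' := fun _ => 0) (-1) (by fun_prop)
    (fun u => hasFDerivAt_fst.prodMk hasFDerivAt_snd.neg) (fun u => hasFDerivAt_const _ _)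
    (fun u hu => by simpa [mem_spectralCurve] using hu)
    (fun u hu v hv => by
      by_cases hs : Complex.sin (2 * Real.pi * u.1) = 0
      · rw [theta_apply_of_eq hs, theta_apply_of_eq (by exact hs)]
        simp [div_neg]
        ring
      · rw [theta_apply_of_ne hs, theta_apply_of_ne (by exact hs)]
        simp [neg_div]
        ring)
  simpa using this

theorem neg_fst (hε : 4 < ε) (h : IsIntegralValue lam ε (x, y) (x', y') w) :
    IsIntegralValue lam ε (-x, y) (-x', y') (-w) := by
  have := h.map hε (M := fun u => (-u.1, u.2))
    (M' := fun _ => (-ContinuousLinearMap.fst ℂ ℂ ℂ).prod (ContinuousLinearMap.snd ℂ ℂ ℂ))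
    (g := fun _ => 0) (g' := fun _ => 0) (-1) (by fun_prop)
    (fun u => hasFDerivAt_fst.neg.prodMk hasFDerivAt_snd) (fun u => hasFDerivAt_const _ _)
    (fun u hu => by simpa [mem_spectralCurve] using hu)
    (fun u hu v hv => by
      by_cases hs : Complex.sin (2 * Real.pi * u.1) = 0
      · have hs' : Complex.sin (2 * Real.pi * -u.1) = 0 := by simpa using hs
        rw [theta_apply_of_eq hs, theta_apply_of_eq (by exact hs')]
        simp [neg_div]
        ring
      · have hs' : Complex.sin (2 * Real.pi * -u.1) ≠ 0 := by simpa using hs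
        rw [theta_apply_of_ne hs, theta_apply_of_ne (by exact hs')]
        simp [div_neg]
        ring)
  simpa using this

theorem add_one_snd (hε : 4 < ε) (h : IsIntegralValue lam ε (x, y) (x', y') w) :
    IsIntegralValue lam ε (x, y + 1) (x', y' + 1) w := by
  have := h.map hε (M := fun u => (u.1, u.2 + 1))
    (M' := fun _ => (ContinuousLinearMap.fst ℂ ℂ ℂ).prod (ContinuousLinearMap.snd ℂ ℂ ℂ))
    (g := fun _ => 0) (g' := fun _ => 0) 1 (by fun_prop)
    (fun u => hasFDerivAt_fst.prodMk (hasFDerivAt_snd.add_const 1)) (fun u => hasFDerivAt_const _ _)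
    (fun u hu => by simpa [mem_spectralCurve, cos_two_pi_mul_add_one] using hu)
    (fun u hu v hv => by
      by_cases hs : Complex.sin (2 * Real.pi * u.1) = 0
      · rw [theta_apply_of_eq hs, theta_apply_of_eq (by exact hs)]
        simp [sin_two_pi_mul_add_one]
      · rw [theta_apply_of_ne hs, theta_apply_of_ne (by exact hs)]
        simp)
  simpa using this

/-- The translation adds the exact form `dy` to `θ`. -/
theorem add_one_fst (hε : 4 < ε) (h : IsIntegralValue lam ε (x, y) (x', y') w) :
    IsIntegralValue lam ε (x + 1, y) (x' + 1, y') (w + (y' - y)) := by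
  have := h.map hε (M := fun u => (u.1 + 1, u.2))
    (M' := fun _ => (ContinuousLinearMap.fst ℂ ℂ ℂ).prod (ContinuousLinearMap.snd ℂ ℂ ℂ))
    (g := fun u => u.2) (g' := fun _ => ContinuousLinearMap.snd ℂ ℂ ℂ) 1 (by fun_prop)
    (fun u => (hasFDerivAt_fst.add_const 1).prodMk hasFDerivAt_snd) (fun u => hasFDerivAt_snd)
    (fun u hu => by simpa [mem_spectralCurve, cos_two_pi_mul_add_one] using hu)
    (fun u hu v hv => by
      by_cases hs : Complex.sin (2 * Real.pi * u.1) = 0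
      · have hs' : Complex.sin (2 * Real.pi * (u.1 + 1)) = 0 := by rwa [sin_two_pi_mul_add_one]
        rw [theta_apply_of_eq hs, theta_apply_of_eq (by exact hs')]
        simp
        ring
      · have hs' : Complex.sin (2 * Real.pi * (u.1 + 1)) ≠ 0 := by rwa [sin_two_pi_mul_add_one]
        rw [theta_apply_of_ne hs, theta_apply_of_ne (by exact hs')]
        simp [sin_two_pi_mul_add_one]
        ring)
  simpa using this

/-- `y dx = d(xy) - x dy`, and `dy / sin (2πx) = -dx / sin (2πy)` changes sign under the exchange.
-/
theorem swap (hε : 4 < ε) (h : IsIntegralValue lam ε (x, y) (x', y') w) :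
    IsIntegralValue lam ε (y, x) (y', x') (x' * y' - x * y - w) := by
  have := h.map hε (M := fun u => (u.2, u.1))
    (M' := fun _ => (ContinuousLinearMap.snd ℂ ℂ ℂ).prod (ContinuousLinearMap.fst ℂ ℂ ℂ))
    (g := fun u => u.1 * u.2)
    (g' := fun u => u.1 • ContinuousLinearMap.snd ℂ ℂ ℂ + u.2 • ContinuousLinearMap.fst ℂ ℂ ℂ)
    (-1) (by fun_prop)
    (fun u => hasFDerivAt_snd.prodMk hasFDerivAt_fst)
    (fun u => hasFDerivAt_fst.mul hasFDerivAt_snd)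
    (fun u hu => by rw [mem_spectralCurve] at hu ⊢; rw [← hu, add_comm])
    (fun u hu v hv => by
      by_cases hs : Complex.sin (2 * Real.pi * u.2) = 0
      · have hs' : Complex.sin (2 * Real.pi * u.1) ≠ 0 := fun h0 =>
          sin_ne_zero_of_sin_eq_zero hε hu h0 hs
        rw [theta_apply_of_eq (by exact hs), theta_apply_of_ne hs']
        simp
        ring
      · rw [theta_apply_of_ne (by exact hs), theta_apply_snd_ne lam hv hs]
        simp
        ring)
  convert this using 1
  ring

end IsIntegralValue

/-! ### Local parametrizations -/

theorem hasDerivAt_cos_two_pi (z : ℂ) : HasDerivAt (fun z : ℂ => Complex.cos (2 * Real.pi * z))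
    (-(2 * Real.pi) * Complex.sin (2 * Real.pi * z)) z := by
  have := (Complex.hasDerivAt_cos (2 * Real.pi * z)).comp z
    ((hasDerivAt_id z).const_mul (2 * Real.pi : ℂ))
  simpa [mul_comm, Function.comp_def] using this

theorem hasDerivAt_sin_two_pi (z : ℂ) : HasDerivAt (fun z : ℂ => Complex.sin (2 * Real.pi * z))
    (2 * Real.pi * Complex.cos (2 * Real.pi * z)) z := by
  have := (Complex.hasDerivAt_sin (2 * Real.pi * z)).comp z
    ((hasDerivAt_id z).const_mul (2 * Real.pi : ℂ))
  simpa [mul_comm, Function.comp_def] using this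

theorem two_pi_ne_zero' : (2 * Real.pi : ℂ) ≠ 0 := by simp [Real.pi_ne_zero]

theorem exists_local_inverse_cos {x₀ : ℂ} (h : Complex.sin (2 * Real.pi * x₀) ≠ 0) :
    ∃ g : ℂ → ℂ, g (Complex.cos (2 * Real.pi * x₀)) = x₀ ∧
      (∀ᶠ c in 𝓝 (Complex.cos (2 * Real.pi * x₀)), DifferentiableAt ℂ g c) ∧
      ∀ᶠ c in 𝓝 (Complex.cos (2 * Real.pi * x₀)), Complex.cos (2 * Real.pi * g c) = c := by
  have hcd : ContDiffAt ℂ 1 (fun z : ℂ => Complex.cos (2 * Real.pi * z)) x₀ :=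
    (Complex.contDiff_cos.comp (by fun_prop)).contDiffAt
  have hd' : -(2 * Real.pi) * Complex.sin (2 * Real.pi * x₀) ≠ 0 :=
    mul_ne_zero (neg_ne_zero.2 two_pi_ne_zero') h
  have hd : HasFDerivAt (fun z : ℂ => Complex.cos (2 * Real.pi * z))
      ((ContinuousLinearEquiv.unitsEquivAut ℂ (Units.mk0 _ hd') : ℂ ≃L[ℂ] ℂ) : ℂ →L[ℂ] ℂ) x₀ :=
    (hasDerivAt_cos_two_pi x₀).hasFDerivAt_equiv hd'
  refine ⟨hcd.localInverse hd one_ne_zero, hcd.localInverse_apply_image hd one_ne_zero, ?_, ?_⟩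
  · have := hcd.to_localInverse hd one_ne_zero
    exact (this.eventually (by simp)).mono fun c hc => hc.differentiableAt one_ne_zero
  · exact (hcd.hasStrictFDerivAt' hd one_ne_zero).eventually_right_inverse

/-- Near a point with `sin (2πx) ≠ 0` the coordinate `y` parametrizes the curve. -/
theorem exists_chart_snd {ε : ℝ} (lam : ℂ) {x₀ y₀ : ℂ} (hmem : (x₀, y₀) ∈ spectralCurve ε)
    (hs : Complex.sin (2 * Real.pi * x₀) ≠ 0) :
    ∃ r > 0, ∃ X G : ℂ → ℂ, X y₀ = x₀ ∧ G y₀ = 0 ∧ DifferentiableOn ℂ X (Metric.ball y₀ r) ∧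
      ∀ y ∈ Metric.ball y₀ r, Complex.sin (2 * Real.pi * X y) ≠ 0 ∧ (X y, y) ∈ spectralCurve ε ∧
        HasDerivAt G (X y + lam / Complex.sin (2 * Real.pi * X y)) y ∧
        IsIntegralValue lam ε (x₀, y₀) (X y, y) (G y) := by
  obtain ⟨g, hg0, hgd, hgi⟩ := exists_local_inverse_cos hs
  have hmem' : (ε : ℂ) / 2 - Complex.cos (2 * Real.pi * y₀) = Complex.cos (2 * Real.pi * x₀) := by
    rw [mem_spectralCurve] at hmem
    simp only at hmem
    rw [← hmem]
    ring
  let c : ℂ → ℂ := fun y => (ε : ℂ) / 2 - Complex.cos (2 * Real.pi * y)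
  have hcdiff : Differentiable ℂ c := fun y =>
    (differentiableAt_const _).sub (hasDerivAt_cos_two_pi y).differentiableAt
  have hct : Tendsto c (𝓝 y₀) (𝓝 (Complex.cos (2 * Real.pi * x₀))) := by
    rw [← hmem']
    exact hcdiff.continuous.continuousAt
  have hgc : ContinuousAt (fun y => Complex.sin (2 * Real.pi * g (c y))) y₀ := by
    have : ContinuousAt (fun y => g (c y)) y₀ := by
      refine ContinuousAt.comp (g := g) ?_ hcdiff.continuous.continuousAt
      change ContinuousAt g ((ε : ℂ) / 2 - Complex.cos (2 * Real.pi * y₀))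
      rw [hmem']
      exact hgd.self_of_nhds.continuousAt
    exact Complex.continuous_sin.continuousAt.comp (continuousAt_const.mul this)
  have hne : ∀ᶠ y in 𝓝 y₀, Complex.sin (2 * Real.pi * g (c y)) ≠ 0 := by
    refine hgc.eventually_ne ?_
    change Complex.sin (2 * Real.pi * g ((ε : ℂ) / 2 - Complex.cos (2 * Real.pi * y₀))) ≠ 0
    rwa [hmem', hg0]
  obtain ⟨r, hr, hball⟩ := Metric.eventually_nhds_iff_ball.1
    ((hct.eventually hgd).and ((hct.eventually hgi).and hne))
  have hXd : DifferentiableOn ℂ (fun y => g (c y)) (Metric.ball y₀ r) := fun y hy =>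
    ((hball y hy).1.comp y (hcdiff y)).differentiableWithinAt
  have hωd : DifferentiableOn ℂ (fun y => g (c y) + lam / Complex.sin (2 * Real.pi * g (c y)))
      (Metric.ball y₀ r) :=
    hXd.add ((differentiableOn_const _).div (hXd.const_mul _).csin fun y hy => (hball y hy).2.2)
  obtain ⟨G, hG0, hG⟩ := hωd.isExactOn_ball.with_val_at y₀ 0
  have hX0 : g (c y₀) = x₀ := by
    change g ((ε : ℂ) / 2 - Complex.cos (2 * Real.pi * y₀)) = x₀
    rw [hmem', hg0]
  have hon : ∀ y ∈ Metric.ball y₀ r, (g (c y), y) ∈ spectralCurve ε := fun y hy => by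
    rw [mem_spectralCurve]
    simp only
    rw [(hball y hy).2.1]
    simp [c]
  refine ⟨r, hr, fun y => g (c y), G, hX0, hG0, hXd, fun y hy => ⟨(hball y hy).2.2, hon y hy,
    hG y hy, ?_⟩⟩
  -- The required path lies over the straight segment from `y₀` to `y`; along it the integrand is
  -- the derivative of `G ∘ l`.
  let l : ℝ → ℂ := fun t => y₀ + t * (y - y₀)
  have hl : ∀ t ∈ Icc (0 : ℝ) 1, l t ∈ Metric.ball y₀ r := by
    intro t ht
    rw [Metric.mem_ball, dist_eq_norm] at hy ⊢
    simp only [l, add_sub_cancel_left, norm_mul, Complex.norm_real, Real.norm_eq_abs,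
      abs_of_nonneg ht.1]
    nlinarith [ht.2, norm_nonneg (y - y₀)]
  have hld : ∀ t, HasDerivAt l (y - y₀) t := fun t => by
    have := ((Complex.ofRealCLM.hasDerivAt (x := t)).mul_const (y - y₀)).const_add y₀
    simpa [l] using this
  have hlc : ContDiff ℝ 1 l := by
    have : ContDiff ℝ 1 (fun t : ℝ => (t : ℂ)) := Complex.ofRealCLM.contDiff
    fun_prop
  have hXc : ContDiffOn ℝ 1 (fun t => g (c (l t))) (Icc 0 1) :=
    ((hXd.contDiffOn Metric.isOpen_ball).restrict_scalars ℝ).comp hlc.contDiffOn hl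
  have hval := isIntegralValue_of_contDiffOn (lam := lam) (ε := ε)
    (f := fun t => (g (c (l t)), l t)) (hXc.prodMk hlc.contDiffOn) (fun t ht => hon _ (hl t ht))
  have hint : ∫ t in (0 : ℝ)..1, theta lam (g (c (l t)), l t)
      (deriv (fun t => (g (c (l t)), l t)) t) = G (l 1) - G (l 0) := by
    have hderiv : ∀ t ∈ Icc (0 : ℝ) 1, HasDerivAt (fun t => G (l t))
        ((g (c (l t)) + lam / Complex.sin (2 * Real.pi * g (c (l t)))) * (y - y₀)) t :=
      fun t ht => (hG _ (hl t ht)).comp t (hld t)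
    rw [← intervalIntegral.integral_eq_sub_of_hasDerivAt
      (f' := fun t => (g (c (l t)) + lam / Complex.sin (2 * Real.pi * g (c (l t)))) * (y - y₀))
      (fun t ht => hderiv t (by rwa [uIcc_of_le zero_le_one] at ht))]
    · refine intervalIntegral.integral_congr fun t ht => ?_
      rw [uIcc_of_le zero_le_one] at ht
      have hXt : DifferentiableAt ℝ (fun t => g (c (l t))) t :=
        DifferentiableAt.comp (g := fun y => g (c y)) t (((hXd.differentiableAt
          (Metric.isOpen_ball.mem_nhds (hl t ht))).restrictScalars ℝ)) (hld t).differentiableAt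
      have hpt := hXt.hasDerivAt.prodMk (hld t)
      rw [hpt.deriv, theta_apply_of_ne (by exact (hball _ (hl t ht)).2.2)]
      ring
    · refine ContinuousOn.intervalIntegrable_of_Icc zero_le_one ?_
      exact (hωd.continuousOn.comp hlc.continuous.continuousOn hl).mul continuousOn_const
  rw [hint] at hval
  simpa [l, hX0, hG0] using hval

/-- Near a point with `sin (2πy) ≠ 0` the coordinate `x` parametrizes the curve. -/
theorem exists_chart_fst {ε : ℝ} (hε : 4 < ε) (lam : ℂ) {x₀ y₀ : ℂ}
    (hmem : (x₀, y₀) ∈ spectralCurve ε) (hs : Complex.sin (2 * Real.pi * y₀) ≠ 0) :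
    ∃ r > 0, ∃ Y G : ℂ → ℂ, Y x₀ = y₀ ∧ G x₀ = 0 ∧ DifferentiableOn ℂ Y (Metric.ball x₀ r) ∧
      ∀ x ∈ Metric.ball x₀ r, Complex.sin (2 * Real.pi * Y x) ≠ 0 ∧ (x, Y x) ∈ spectralCurve ε ∧
        HasDerivAt G
          (-(x * Complex.sin (2 * Real.pi * x) + lam) / Complex.sin (2 * Real.pi * Y x)) x ∧
        IsIntegralValue lam ε (x₀, y₀) (x, Y x) (G x) := by
  obtain ⟨r, hr, Y, G, hY0, hG0, hYd, hY⟩ := exists_chart_snd lam (x₀ := y₀) (y₀ := x₀) (ε := ε)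
    (by rw [mem_spectralCurve] at hmem ⊢; rw [← hmem, add_comm]) hs
  have hYmem : ∀ x ∈ Metric.ball x₀ r, (x, Y x) ∈ spectralCurve ε := fun x hx => by
    have := (hY x hx).2.1
    rw [mem_spectralCurve] at this ⊢
    rw [← this, add_comm]
  -- The chart at the exchanged point is carried back by `swap`. The new derivative is `x Y' - lam /
  -- sin (2πY)`, and tangency gives `Y' = -sin (2πx) / sin (2πY)`.
  refine ⟨r, hr, Y, fun x => x * Y x - x₀ * y₀ - G x, hY0, by simp [hY0, hG0], hYd,
    fun x hx => ⟨(hY x hx).1, hYmem x hx, ?_, ?_⟩⟩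
  · obtain ⟨hne, -, hGd, -⟩ := hY x hx
    have hYx := (hYd.differentiableAt (Metric.isOpen_ball.mem_nhds hx)).hasDerivAt
    have h1 := (hasDerivAt_cos_two_pi x).add ((hasDerivAt_cos_two_pi (Y x)).comp x hYx)
    have h2 : HasDerivAt (fun _ : ℂ => (ε : ℂ) / 2) 0 x := hasDerivAt_const _ _
    have h3 := h1.unique (h2.congr_of_eventuallyEq
      (eventually_of_mem (Metric.isOpen_ball.mem_nhds hx) fun u hu => hYmem u hu))
    have h4 : Complex.sin (2 * Real.pi * x) + Complex.sin (2 * Real.pi * Y x) * deriv Y x = 0 := by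
      apply mul_left_cancel₀ two_pi_ne_zero'
      linear_combination -h3
    have h5 := (((hasDerivAt_id x).mul hYx).sub_const (x₀ * y₀)).sub hGd
    refine HasDerivAt.congr_deriv h5 (Eq.symm ?_)
    simp only [id]
    rw [div_eq_iff hne, sub_mul, add_mul _ (lam / _), div_mul_cancel₀ _ hne]
    linear_combination -x * h4
  · have := (hY x hx).2.2.2.swap hε
    convert this using 1
    ring

theorem not_eventually_cos_eq (y₀ c : ℂ) :
    ¬ ∀ᶠ y in 𝓝 y₀, Complex.cos (2 * Real.pi * y) = c := by
  intro h
  have h1 : ∀ᶠ y in 𝓝 y₀, Complex.sin (2 * Real.pi * y) = 0 := by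
    filter_upwards [h.eventually_nhds] with y hy
    have := (hasDerivAt_cos_two_pi y).unique ((hasDerivAt_const y c).congr_of_eventuallyEq hy)
    simpa [two_pi_ne_zero', Real.pi_ne_zero] using this
  have h2 := (hasDerivAt_sin_two_pi y₀).unique ((hasDerivAt_const y₀ 0).congr_of_eventuallyEq h1)
  have h3 : Complex.cos (2 * Real.pi * y₀) = 0 := by
    simpa [Real.pi_ne_zero] using h2
  have := Complex.sin_sq_add_cos_sq (2 * Real.pi * y₀)
  rw [h1.self_of_nhds, h3] at this
  simp at this

/-- The first coordinate is an open map in the parametrization by the second one. -/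
theorem nhds_le_map_of_chart {ε r : ℝ} {y₀ : ℂ} (hr : 0 < r) {X : ℂ → ℂ}
    (hXd : DifferentiableOn ℂ X (Metric.ball y₀ r))
    (hX : ∀ y ∈ Metric.ball y₀ r, (X y, y) ∈ spectralCurve ε) : 𝓝 (X y₀) ≤ map X (𝓝 y₀) := by
  have hnhds : Metric.ball y₀ r ∈ 𝓝 y₀ := Metric.ball_mem_nhds y₀ hr
  -- Open mapping theorem: if `X` were locally constant, the curve equation would make `cos (2πy)`
  -- locally constant.
  refine (hXd.analyticAt hnhds).eventually_constant_or_nhds_le_map_nhds.resolve_left fun h => ?_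
  refine not_eventually_cos_eq y₀ ((ε : ℂ) / 2 - Complex.cos (2 * Real.pi * X y₀)) ?_
  filter_upwards [h, hnhds] with y hy hy'
  have := hX y hy'
  rw [mem_spectralCurve] at this
  simp only at this
  rw [← this, hy]
  ring

theorem eventually_exists_isIntegralValue {ε : ℝ} (hε : 4 < ε) (lam : ℂ) {x₀ y₀ : ℂ}
    (hmem : (x₀, y₀) ∈ spectralCurve ε) :
    ∀ᶠ x in 𝓝 x₀, ∃ y w, IsIntegralValue lam ε (x₀, y₀) (x, y) w := by
  by_cases hs : Complex.sin (2 * Real.pi * x₀) = 0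
  · obtain ⟨r, hr, Y, G, -, -, -, hY⟩ := exists_chart_fst hε lam hmem
      (sin_ne_zero_of_sin_eq_zero hε hmem hs)
    filter_upwards [Metric.ball_mem_nhds x₀ hr] with x hx
    exact ⟨Y x, G x, (hY x hx).2.2.2⟩
  · obtain ⟨r, hr, X, G, hX0, -, hXd, hX⟩ := exists_chart_snd lam hmem hs
    have := nhds_le_map_of_chart hr hXd fun y hy => (hX y hy).2.1
    rw [hX0] at this
    have himg := this (image_mem_map (Metric.ball_mem_nhds y₀ hr))
    filter_upwards [himg]
    rintro _ ⟨y, hy, rfl⟩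
    exact ⟨y, G y, (hX y hy).2.2.2⟩

/-! ### The function `r` and the path with real `y` -/

theorem one_lt_cosh_alpha {ε : ℝ} (hε : 4 < ε) : 1 < Real.cosh (2 * Real.pi * alpha ε) :=
  Real.one_lt_cosh.2 (by have := alpha_pos hε; positivity)

theorem one_lt_rFun_arg {ε : ℝ} (hε : 4 < ε) (t : ℝ) :
    1 < 1 - Real.cos (Real.pi * t) + Real.cosh (2 * Real.pi * alpha ε) := by
  linarith [one_lt_cosh_alpha hε, Real.cos_le_one (Real.pi * t)]

theorem two_pi_mul_rFun (ε t : ℝ) : 2 * Real.pi * rFun ε t =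
    Real.arcosh (1 - Real.cos (Real.pi * t) + Real.cosh (2 * Real.pi * alpha ε)) := by
  unfold rFun
  field_simp

theorem cosh_rFun {ε : ℝ} (hε : 4 < ε) (t : ℝ) : Real.cosh (2 * Real.pi * rFun ε t) =
    1 - Real.cos (Real.pi * t) + Real.cosh (2 * Real.pi * alpha ε) := by
  rw [two_pi_mul_rFun, Real.cosh_arcosh (one_lt_rFun_arg hε t).le]

theorem alpha_le_rFun {ε : ℝ} (hε : 4 < ε) (t : ℝ) : alpha ε ≤ rFun ε t := by
  have hα := alpha_pos hε
  have h : 2 * Real.pi * alpha ε ≤ 2 * Real.pi * rFun ε t := by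
    rw [two_pi_mul_rFun]
    nth_rewrite 1 [← Real.arcosh_cosh (x := 2 * Real.pi * alpha ε) (by positivity)]
    rw [Real.arcosh_le_arcosh (by positivity) (by linarith [one_lt_rFun_arg hε t])]
    linarith [Real.cos_le_one (Real.pi * t)]
  exact le_of_mul_le_mul_left h (by positivity)

theorem rFun_zero {ε : ℝ} (hε : 4 < ε) : rFun ε 0 = alpha ε := by
  have hα := alpha_pos hε
  have h : 2 * Real.pi * rFun ε 0 = 2 * Real.pi * alpha ε := by
    rw [two_pi_mul_rFun]
    simp only [mul_zero, Real.cos_zero, sub_self, zero_add]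
    exact Real.arcosh_cosh (by positivity)
  exact mul_left_cancel₀ (by positivity) h

theorem rFun_two_sub (ε t : ℝ) : rFun ε (2 - t) = rFun ε t := by
  unfold rFun
  rw [show Real.pi * (2 - t) = 2 * Real.pi - Real.pi * t by ring, Real.cos_two_pi_sub]

theorem contDiff_rFun {ε : ℝ} (hε : 4 < ε) : ContDiff ℝ 1 (rFun ε) := by
  refine ContDiff.div_const ?_ _
  refine contDiff_iff_contDiffAt.2 fun t => ?_
  refine ContDiffAt.comp (g := Real.arcosh) t (Real.contDiffAt_arcosh (one_lt_rFun_arg hε t)) ?_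
  have : ContDiff ℝ 1 fun t => 1 - Real.cos (Real.pi * t) + Real.cosh (2 * Real.pi * alpha ε) := by
    fun_prop
  exact this.contDiffAt

theorem sinh_rFun_pos {ε : ℝ} (hε : 4 < ε) (t : ℝ) : 0 < Real.sinh (2 * Real.pi * rFun ε t) := by
  have := (alpha_pos hε).trans_le (alpha_le_rFun hε t)
  exact Real.sinh_pos_iff.2 (by positivity)

theorem cos_two_pi_I (u : ℝ) :
    Complex.cos (2 * Real.pi * (Complex.I * u)) = Real.cosh (2 * Real.pi * u) := by
  rw [show (2 * Real.pi * (Complex.I * u) : ℂ) = ((2 * Real.pi * u : ℝ) : ℂ) * Complex.I by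
    push_cast; ring, Complex.cos_mul_I, Complex.ofReal_cosh]

theorem sin_two_pi_I (u : ℝ) :
    Complex.sin (2 * Real.pi * (Complex.I * u)) = Real.sinh (2 * Real.pi * u) * Complex.I := by
  rw [show (2 * Real.pi * (Complex.I * u) : ℂ) = ((2 * Real.pi * u : ℝ) : ℂ) * Complex.I by
    push_cast; ring, Complex.sin_mul_I, Complex.ofReal_sinh]

theorem half_eq_one_add_cosh {ε : ℝ} (hε : 4 < ε) :
    (ε : ℂ) / 2 = ((1 + Real.cosh (2 * Real.pi * alpha ε) : ℝ) : ℂ) := by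
  have h : ε / 2 = 1 + Real.cosh (2 * Real.pi * alpha ε) := by linarith [alpha_spec hε]
  rw [← h]
  push_cast
  ring

/-- The paths run through a full period `[0, 2]` at double speed. By the symmetry about `1` both
halves contribute equally, which cancels the factor `1 / 2`. -/
theorem integral_comp_two_mul_of_symm {h : ℝ → ℝ} (hc : Continuous h)
    (hs : ∀ t, h (2 - t) = h t) : ∫ t in (0 : ℝ)..1, h (2 * t) = ∫ t in (0 : ℝ)..1, h t := by
  have h1 : ∫ t in (1 : ℝ)..2, h t = ∫ t in (0 : ℝ)..1, h t := by
    have := intervalIntegral.integral_comp_sub_left (a := 0) (b := 1) h 2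
    simp only [hs] at this
    rw [this]
    norm_num
  rw [intervalIntegral.integral_comp_mul_left _ two_ne_zero, mul_zero, mul_one,
    ← intervalIntegral.integral_add_adjacent_intervals (hc.intervalIntegrable 0 1)
    (hc.intervalIntegrable 1 2), h1, smul_eq_mul]
  ring

theorem continuous_inv_sinh_rFun {ε : ℝ} (hε : 4 < ε) :
    Continuous fun t => 1 / Real.sinh (2 * Real.pi * rFun ε t) := by
  have hr := (contDiff_rFun hε).continuous
  exact continuous_const.div (by fun_prop) fun t => (sinh_rFun_pos hε t).ne'

/-- The integral along the path from the base point to its translate, with real second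
coordinate. -/
theorem isIntegralValue_add_one {ε : ℝ} (hε : 4 < ε) (lam : ℂ) :
    IsIntegralValue lam ε (Complex.I * alpha ε, 0) (Complex.I * alpha ε, 1)
      (Complex.I * (perBtilde ε - lam * perB ε)) := by
  have hr := contDiff_rFun hε
  have hof : ContDiff ℝ 1 (fun t : ℝ => (t : ℂ)) := Complex.ofRealCLM.contDiff
  have hx : ContDiff ℝ 1 (fun t : ℝ => Complex.I * (rFun ε (2 * t) : ℂ)) :=
    contDiff_const.mul (hof.comp (hr.comp (by fun_prop)))
  -- The path is `y = t`, `x = i r(2t)`; it ends over `iα` again because `r(2) = r(0) = α`.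
  have hval := isIntegralValue_of_contDiffOn (lam := lam) (ε := ε)
    (f := fun t => (Complex.I * (rFun ε (2 * t) : ℂ), (t : ℂ)))
    (hx.prodMk hof).contDiffOn (fun t _ => by
      rw [mem_spectralCurve, cos_two_pi_I, cosh_rFun hε, half_eq_one_add_cosh hε,
        show (2 * Real.pi * (t : ℂ) : ℂ) = ((Real.pi * (2 * t) : ℝ) : ℂ) by push_cast; ring,
        ← Complex.ofReal_cos, ← Complex.ofReal_add]
      congr 1
      ring)
  have hint : ∫ t in (0 : ℝ)..1, theta lam (Complex.I * (rFun ε (2 * t) : ℂ), (t : ℂ))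
      (deriv (fun t : ℝ => (Complex.I * (rFun ε (2 * t) : ℂ), (t : ℂ))) t) =
      Complex.I * (perBtilde ε - lam * perB ε) := by
    have h1 : ∀ t : ℝ, theta lam (Complex.I * (rFun ε (2 * t) : ℂ), (t : ℂ))
        (deriv (fun t : ℝ => (Complex.I * (rFun ε (2 * t) : ℂ), (t : ℂ))) t) =
        Complex.I * ((rFun ε (2 * t) : ℂ) -
          lam * ((1 / Real.sinh (2 * Real.pi * rFun ε (2 * t)) : ℝ) : ℂ)) := fun t => by
      have hd := ((hx.differentiable one_ne_zero) t).hasDerivAt.prodMk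
        (Complex.ofRealCLM.hasDerivAt (x := t))
      have hsin : Complex.sin (2 * Real.pi * (Complex.I * (rFun ε (2 * t) : ℂ))) ≠ 0 := by
        rw [sin_two_pi_I]
        exact mul_ne_zero (Complex.ofReal_ne_zero.2 (sinh_rFun_pos hε (2 * t)).ne') Complex.I_ne_zero
      simp only [Complex.ofRealCLM_apply] at hd
      rw [hd.deriv, theta_apply_of_ne (by exact hsin)]
      simp only
      rw [sin_two_pi_I]
      have h0 : ((Real.sinh (2 * Real.pi * rFun ε (2 * t)) : ℝ) : ℂ) ≠ 0 := by
        exact_mod_cast (sinh_rFun_pos hε (2 * t)).ne'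
      simp only [Complex.ofReal_div, Complex.ofReal_one]
      field_simp
      rw [Complex.I_sq]
      ring
    have hr2 : Continuous fun t : ℝ => rFun ε (2 * t) := hr.continuous.comp (by fun_prop)
    have hi2 : Continuous fun t : ℝ => 1 / Real.sinh (2 * Real.pi * rFun ε (2 * t)) :=
      (continuous_inv_sinh_rFun hε).comp (by fun_prop : Continuous fun t : ℝ => 2 * t)
    simp only [h1]
    have hr3 : Continuous fun t : ℝ => (rFun ε (2 * t) : ℂ) := Complex.continuous_ofReal.comp hr2
    have hi3 : Continuous fun t : ℝ =>
        lam * ((1 / Real.sinh (2 * Real.pi * rFun ε (2 * t)) : ℝ) : ℂ) :=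
      continuous_const.mul (Complex.continuous_ofReal.comp hi2)
    rw [intervalIntegral.integral_const_mul, intervalIntegral.integral_sub
      (hr3.intervalIntegrable 0 1) (hi3.intervalIntegrable 0 1),
      intervalIntegral.integral_const_mul, intervalIntegral.integral_ofReal,
      intervalIntegral.integral_ofReal,
      integral_comp_two_mul_of_symm hr.continuous (rFun_two_sub ε),
      integral_comp_two_mul_of_symm (continuous_inv_sinh_rFun hε)
        (fun t => by rw [rFun_two_sub])]
    rfl
  rw [hint] at hval
  have h2 : rFun ε 2 = alpha ε := by
    rw [← rFun_zero hε, ← rFun_two_sub ε 0, sub_zero]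
  simpa [rFun_zero hε, h2] using hval

/-! ### The function `s` and the oval with imaginary coordinates -/

theorem sinh_sFun (ε t : ℝ) : Real.sinh (Real.pi * sFun ε t) =
    Real.sinh (Real.pi * alpha ε) * Real.sin (Real.pi * t) := by
  unfold sFun
  rw [mul_div_cancel₀ _ Real.pi_ne_zero, Real.sinh_arsinh]

theorem sinh_sFun_add_half (ε t : ℝ) : Real.sinh (Real.pi * sFun ε (t + 1 / 2)) =
    Real.sinh (Real.pi * alpha ε) * Real.cos (Real.pi * t) := by
  rw [sinh_sFun, mul_add, mul_one_div, Real.sin_add_pi_div_two]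

theorem sFun_add_one (ε t : ℝ) : sFun ε (t + 1) = -sFun ε t := by
  unfold sFun
  rw [mul_add, mul_one, Real.sin_add_pi, mul_neg, Real.arsinh_neg, neg_div]

theorem sFun_one_sub (ε t : ℝ) : sFun ε (1 - t) = sFun ε t := by
  unfold sFun
  rw [mul_sub, mul_one, Real.sin_pi_sub]

theorem sFun_zero (ε : ℝ) : sFun ε 0 = 0 := by simp [sFun]

theorem sFun_half (ε : ℝ) : sFun ε (1 / 2) = alpha ε := by
  unfold sFun
  rw [mul_one_div, Real.sin_pi_div_two, mul_one, Real.arsinh_sinh,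
    mul_div_cancel_left₀ _ Real.pi_ne_zero]

theorem contDiff_sFun (ε : ℝ) : ContDiff ℝ 2 (sFun ε) := by
  refine ContDiff.div_const ?_ _
  exact Real.contDiff_arsinh.comp (by fun_prop)

theorem hasDerivAt_sFun (ε t : ℝ) : HasDerivAt (sFun ε)
    (Real.sinh (Real.pi * alpha ε) * Real.cos (Real.pi * t) / Real.cosh (Real.pi * sFun ε t)) t := by
  have hd := ((contDiff_sFun ε).differentiable two_ne_zero t).hasDerivAt
  have h1 := (hd.const_mul Real.pi).sinh
  have h2 := (((hasDerivAt_id t).const_mul Real.pi).sin).const_mul (Real.sinh (Real.pi * alpha ε))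
  have h3 := h1.unique (h2.congr_of_eventuallyEq (Eventually.of_forall (sinh_sFun ε)))
  refine hd.congr_deriv ?_
  rw [eq_div_iff (Real.cosh_pos _).ne']
  apply mul_left_cancel₀ Real.pi_ne_zero
  simp only [id, mul_one] at h3
  linear_combination h3

theorem deriv_sFun (ε t : ℝ) : deriv (sFun ε) t =
    Real.sinh (Real.pi * alpha ε) * Real.cos (Real.pi * t) / Real.cosh (Real.pi * sFun ε t) :=
  (hasDerivAt_sFun ε t).deriv

/-- The integrand of `perA`, extended continuously. -/
noncomputable def ovalDensity (ε t : ℝ) : ℝ :=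
  1 / (2 * Real.cosh (Real.pi * sFun ε t) * Real.cosh (Real.pi * sFun ε (t + 1 / 2)))

theorem ovalDensity_pos (ε t : ℝ) : 0 < ovalDensity ε t := by
  have := Real.cosh_pos (Real.pi * sFun ε t)
  have := Real.cosh_pos (Real.pi * sFun ε (t + 1 / 2))
  unfold ovalDensity
  positivity

theorem continuous_sFun (ε : ℝ) : Continuous (sFun ε) := (contDiff_sFun ε).continuous

theorem continuous_deriv_sFun (ε : ℝ) : Continuous (deriv (sFun ε)) :=
  (contDiff_sFun ε).continuous_deriv one_le_two

theorem continuous_ovalDensity (ε : ℝ) : Continuous (ovalDensity ε) := by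
  have := continuous_sFun ε
  unfold ovalDensity
  refine continuous_const.div (by fun_prop) fun t => ?_
  have := Real.cosh_pos (Real.pi * sFun ε t)
  have := Real.cosh_pos (Real.pi * sFun ε (t + 1 / 2))
  positivity

theorem sinh_pi_alpha_pos {ε : ℝ} (hε : 4 < ε) : 0 < Real.sinh (Real.pi * alpha ε) := by
  have := alpha_pos hε
  exact Real.sinh_pos_iff.2 (by positivity)

/-- Both `s'(t)` and `sinh (2π s(t + 1/2))` contain the factor `sinh (πα) cos (πt)`, so the
singularity at `t = 1/2` is removable. -/
theorem deriv_sFun_div {ε : ℝ} (hε : 4 < ε) {t : ℝ} (ht : Real.cos (Real.pi * t) ≠ 0) :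
    deriv (sFun ε) t / Real.sinh (2 * Real.pi * sFun ε (t + 1 / 2)) = ovalDensity ε t := by
  have h0 := (sinh_pi_alpha_pos hε).ne'
  have h1 := (Real.cosh_pos (Real.pi * sFun ε t)).ne'
  have h2 := (Real.cosh_pos (Real.pi * sFun ε (t + 1 / 2))).ne'
  rw [deriv_sFun, mul_assoc, Real.sinh_two_mul, sinh_sFun_add_half, ovalDensity]
  field_simp

theorem deriv_sFun_add_half_div {ε : ℝ} (hε : 4 < ε) {t : ℝ} (ht : Real.sin (Real.pi * t) ≠ 0) :
    deriv (sFun ε) (t + 1 / 2) / Real.sinh (2 * Real.pi * sFun ε t) = -ovalDensity ε t := by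
  have h0 := (sinh_pi_alpha_pos hε).ne'
  have h1 := (Real.cosh_pos (Real.pi * sFun ε t)).ne'
  have h2 := (Real.cosh_pos (Real.pi * sFun ε (t + 1 / 2))).ne'
  rw [deriv_sFun, mul_assoc 2, Real.sinh_two_mul, sinh_sFun, ovalDensity, mul_add, mul_one_div,
    Real.cos_add_pi_div_two]
  field_simp

theorem cos_pi_mul_pos {t : ℝ} (ht : t ∈ Ioo (0 : ℝ) (1 / 2)) : 0 < Real.cos (Real.pi * t) := by
  have := Real.pi_pos
  exact Real.cos_pos_of_mem_Ioo ⟨by nlinarith [ht.1], by nlinarith [ht.2]⟩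

theorem perA_eq {ε : ℝ} (hε : 4 < ε) :
    perA ε = 4 * ∫ t in (0 : ℝ)..(1 / 2), ovalDensity ε t := by
  unfold perA
  congr 1
  rw [intervalIntegral.integral_of_le (by norm_num), intervalIntegral.integral_of_le (by norm_num),
    ← restrict_Ioo_eq_restrict_Ioc]
  exact setIntegral_congr_fun measurableSet_Ioo fun t ht => deriv_sFun_div hε (cos_pi_mul_pos ht).ne'

/-- The oval consists of four congruent quarters; this factor `2` and the speed `2` of the
parametrization make the `4` in `perA` and `perAtilde`. -/
theorem integral_two_mul_comp_two_mul {h : ℝ → ℝ} (hc : Continuous h) (h1 : ∀ t, h (t + 1) = h t)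
    (h2 : ∀ t, h (1 - t) = h t) :
    ∫ t in (0 : ℝ)..1, h (2 * t) = 2 * ∫ t in (0 : ℝ)..(1 / 2), h t := by
  have e1 : ∫ t in (1 / 2 : ℝ)..1, h t = ∫ t in (0 : ℝ)..(1 / 2), h t := by
    have := intervalIntegral.integral_comp_sub_left (a := 0) (b := 1 / 2) h 1
    simp only [h2] at this
    rw [this]
    norm_num
  rw [integral_comp_two_mul_of_symm hc (fun t => by
      rw [show 2 - t = (1 - t) + 1 by ring, h1, h2]),
    ← intervalIntegral.integral_add_adjacent_intervals (hc.intervalIntegrable 0 (1 / 2))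
    (hc.intervalIntegrable (1 / 2) 1), e1]
  ring

theorem deriv_sFun_add_one (ε t : ℝ) : deriv (sFun ε) (t + 1) = -deriv (sFun ε) t := by
  rw [deriv_sFun, deriv_sFun, sFun_add_one, mul_add, mul_one, Real.cos_add_pi, mul_neg,
    mul_neg, Real.cosh_neg]
  ring

theorem deriv_sFun_one_sub (ε t : ℝ) : deriv (sFun ε) (1 - t) = -deriv (sFun ε) t := by
  rw [deriv_sFun, deriv_sFun, sFun_one_sub, mul_sub, mul_one, Real.cos_pi_sub]
  ring

theorem sFun_one_sub_add_half (ε t : ℝ) : sFun ε (1 - t + 1 / 2) = -sFun ε (t + 1 / 2) := by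
  rw [show 1 - t + 1 / 2 = 1 - (t - 1 / 2) by ring, sFun_one_sub,
    show t + 1 / 2 = (t - 1 / 2) + 1 by ring, sFun_add_one, neg_neg]

theorem cosh_alpha_eq (ε : ℝ) :
    Real.cosh (2 * Real.pi * alpha ε) = 1 + 2 * Real.sinh (Real.pi * alpha ε) ^ 2 := by
  rw [mul_assoc, Real.cosh_two_mul, Real.cosh_sq]
  ring

theorem I_mul_div_mul_I (a b : ℂ) : Complex.I * a / (b * Complex.I) = a / b := by
  rw [mul_comm Complex.I, mul_div_mul_right _ _ Complex.I_ne_zero]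

/-- The integral along the oval with imaginary coordinates. -/
theorem isIntegralValue_oval {ε : ℝ} (hε : 4 < ε) (lam : ℂ) :
    IsIntegralValue lam ε (Complex.I * alpha ε, 0) (Complex.I * alpha ε, 0)
      (perA ε * lam - perAtilde ε) := by
  have hs : ContDiff ℝ 1 (sFun ε) := (contDiff_sFun ε).of_le one_le_two
  have hof : ContDiff ℝ 1 (fun t : ℝ => (t : ℂ)) := Complex.ofRealCLM.contDiff
  -- With `cosh (2πu) = 1 + 2 sinh² (πu)`, the equation of the curve becomes `sin² + cos² = 1` for
  -- the angle `2πt`.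
  let X : ℝ → ℂ := fun t => Complex.I * (sFun ε (2 * t + 1 / 2) : ℂ)
  let Y : ℝ → ℂ := fun t => Complex.I * (sFun ε (2 * t) : ℂ)
  have hX : ContDiff ℝ 1 X := contDiff_const.mul (hof.comp (hs.comp (by fun_prop)))
  have hY : ContDiff ℝ 1 Y := contDiff_const.mul (hof.comp (hs.comp (by fun_prop)))
  have hXd : ∀ t, HasDerivAt X (Complex.I * (2 * deriv (sFun ε) (2 * t + 1 / 2) : ℝ)) t :=
    fun t => by
      have h1 : HasDerivAt (fun t : ℝ => 2 * t + 1 / 2) 2 t := by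
        simpa using ((hasDerivAt_id t).const_mul (2 : ℝ)).add_const (1 / 2)
      have h2 := ((hasDerivAt_sFun ε _).comp t h1).ofReal_comp.const_mul Complex.I
      rw [← deriv_sFun] at h2
      simpa [X, mul_comm] using h2
  have hYd : ∀ t, HasDerivAt Y (Complex.I * (2 * deriv (sFun ε) (2 * t) : ℝ)) t :=
    fun t => by
      have h1 : HasDerivAt (fun t : ℝ => 2 * t) 2 t := by
        simpa using (hasDerivAt_id t).const_mul (2 : ℝ)
      have h2 := ((hasDerivAt_sFun ε _).comp t h1).ofReal_comp.const_mul Complex.I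
      rw [← deriv_sFun] at h2
      simpa [Y, mul_comm] using h2
  have hval := isIntegralValue_of_contDiffOn (lam := lam) (ε := ε)
    (f := fun t => (X t, Y t)) (hX.prodMk hY).contDiffOn (fun t _ => by
      rw [mem_spectralCurve, half_eq_one_add_cosh hε]
      simp only [X, Y]
      rw [cos_two_pi_I, cos_two_pi_I, ← Complex.ofReal_add]
      congr 1
      rw [cosh_alpha_eq, mul_assoc, Real.cosh_two_mul, mul_assoc 2 Real.pi (sFun ε (2 * t)),
        Real.cosh_two_mul, Real.cosh_sq, Real.cosh_sq, sinh_sFun_add_half, sinh_sFun]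
      linear_combination 2 * Real.sinh (Real.pi * alpha ε) ^ 2 *
        Real.sin_sq_add_cos_sq (Real.pi * (2 * t)))
  have hpt : ∀ t : ℝ, theta lam (X t, Y t) (deriv (fun t => (X t, Y t)) t) =
      2 * (lam * ((ovalDensity ε (2 * t) : ℝ) : ℂ) -
        ((sFun ε (2 * t + 1 / 2) * deriv (sFun ε) (2 * t) : ℝ) : ℂ)) := fun t => by
    rw [((hXd t).prodMk (hYd t)).deriv]
    -- These are the points of the oval with `x = 0`, where `theta` uses `dx`.
    by_cases hc : Real.cos (Real.pi * (2 * t)) = 0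
    · have hsn : Real.sin (Real.pi * (2 * t)) ≠ 0 := fun h0 => by
        have := Real.sin_sq_add_cos_sq (Real.pi * (2 * t))
        rw [h0, hc] at this
        norm_num at this
      have hsin : Complex.sin (2 * Real.pi * X t) = 0 := by
        simp only [X]
        rw [sin_two_pi_I, mul_assoc 2, Real.sinh_two_mul, sinh_sFun_add_half, hc]
        simp
      rw [theta_apply_of_eq (by exact hsin)]
      simp only [X, Y]
      rw [sin_two_pi_I, I_mul_div_mul_I, ← Complex.ofReal_div, mul_div_assoc,
        deriv_sFun_add_half_div hε hsn]
      push_cast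
      linear_combination 2 * (sFun ε (2 * t + 1 / 2) : ℂ) * ((deriv (sFun ε) (2 * t) : ℝ) : ℂ) *
        Complex.I_sq
    · have hsin : Complex.sin (2 * Real.pi * X t) ≠ 0 := by
        simp only [X]
        rw [sin_two_pi_I, mul_assoc 2, Real.sinh_two_mul, sinh_sFun_add_half]
        refine mul_ne_zero (Complex.ofReal_ne_zero.2 ?_) Complex.I_ne_zero
        exact mul_ne_zero (mul_ne_zero two_ne_zero (mul_ne_zero (sinh_pi_alpha_pos hε).ne' hc))
          (Real.cosh_pos _).ne'
      rw [theta_apply_of_ne (by exact hsin)]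
      simp only [X]
      rw [sin_two_pi_I, I_mul_div_mul_I, ← Complex.ofReal_div, mul_div_assoc,
        deriv_sFun_div hε hc]
      push_cast
      linear_combination 2 * (sFun ε (2 * t + 1 / 2) : ℂ) * ((deriv (sFun ε) (2 * t) : ℝ) : ℂ) *
        Complex.I_sq
  have hprod : Continuous fun t => sFun ε (t + 1 / 2) * deriv (sFun ε) t :=
    ((continuous_sFun ε).comp (by fun_prop)).mul (continuous_deriv_sFun ε)
  have hcomp : Continuous fun t : ℝ => 2 * t := by fun_prop
  have hint : ∫ t in (0 : ℝ)..1, theta lam (X t, Y t) (deriv (fun t => (X t, Y t)) t) =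
      perA ε * lam - perAtilde ε := by
    have hi1 : Continuous fun t : ℝ => lam * ((ovalDensity ε (2 * t) : ℝ) : ℂ) :=
      continuous_const.mul (Complex.continuous_ofReal.comp ((continuous_ovalDensity ε).comp hcomp))
    have hi2 : Continuous fun t : ℝ =>
        ((sFun ε (2 * t + 1 / 2) * deriv (sFun ε) (2 * t) : ℝ) : ℂ) :=
      Complex.continuous_ofReal.comp (hprod.comp hcomp)
    simp only [hpt]
    rw [intervalIntegral.integral_const_mul, intervalIntegral.integral_sub
      (hi1.intervalIntegrable 0 1) (hi2.intervalIntegrable 0 1),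
      intervalIntegral.integral_const_mul, intervalIntegral.integral_ofReal,
      intervalIntegral.integral_ofReal,
      integral_two_mul_comp_two_mul (continuous_ovalDensity ε)
        (fun t => by
          unfold ovalDensity
          rw [show t + 1 + 1 / 2 = t + 1 / 2 + 1 by ring, sFun_add_one, sFun_add_one, mul_neg,
            mul_neg, Real.cosh_neg, Real.cosh_neg])
        (fun t => by
          unfold ovalDensity
          rw [sFun_one_sub, sFun_one_sub_add_half, mul_neg, Real.cosh_neg]),
      integral_two_mul_comp_two_mul (h := fun t => sFun ε (t + 1 / 2) * deriv (sFun ε) t) hprod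
        (fun t => by
          rw [show t + 1 + 1 / 2 = t + 1 / 2 + 1 by ring, sFun_add_one, deriv_sFun_add_one,
            neg_mul_neg])
        (fun t => by rw [sFun_one_sub_add_half, deriv_sFun_one_sub, neg_mul_neg]),
      perA_eq hε, perAtilde]
    push_cast
    ring
  rw [hint] at hval
  have e1 : sFun ε (2 * 0 + 1 / 2) = alpha ε := by rw [mul_zero, zero_add, sFun_half]
  have e2 : sFun ε (2 * 1 + 1 / 2) = alpha ε := by
    rw [show (2 * 1 + 1 / 2 : ℝ) = 1 / 2 + 1 + 1 by norm_num, sFun_add_one, sFun_add_one, neg_neg,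
      sFun_half]
  have e3 : sFun ε (2 * 0) = 0 := by rw [mul_zero, sFun_zero]
  have e4 : sFun ε (2 * 1) = 0 := by
    rw [show (2 * 1 : ℝ) = 0 + 1 + 1 by norm_num, sFun_add_one, sFun_add_one, neg_neg, sFun_zero]
  simp only [X, Y] at hval
  rw [e1, e2, e3, e4] at hval
  simpa using hval

/-! ### Comparison of the period integrals -/

theorem perA_pos {ε : ℝ} (hε : 4 < ε) : 0 < perA ε := by
  rw [perA_eq hε]
  exact mul_pos (by norm_num) (intervalIntegral.intervalIntegral_pos_of_pos_on
    ((continuous_ovalDensity ε).intervalIntegrable _ _) (fun t _ => ovalDensity_pos ε t)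
    (by norm_num))

theorem perB_pos {ε : ℝ} (hε : 4 < ε) : 0 < perB ε :=
  intervalIntegral.intervalIntegral_pos_of_pos_on
    ((continuous_inv_sinh_rFun hε).intervalIntegrable _ _)
    (fun t _ => one_div_pos.2 (sinh_rFun_pos hε t)) one_pos

/-- The common bound for the two ratios of period integrals. -/
noncomputable def ratioBound (ε : ℝ) : ℝ :=
  alpha ε * Real.sinh (2 * Real.pi * alpha ε)

theorem ratioBound_pos {ε : ℝ} (hε : 4 < ε) : 0 < ratioBound ε := by
  have := alpha_pos hε
  exact mul_pos this (Real.sinh_pos_iff.2 (by positivity))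

/-- Pointwise, since `u sinh (2πu)` increases for `u ≥ 0` and `r ≥ α`. -/
theorem ratioBound_mul_perB_le {ε : ℝ} (hε : 4 < ε) : ratioBound ε * perB ε ≤ perBtilde ε := by
  unfold perB perBtilde
  rw [← intervalIntegral.integral_const_mul]
  refine intervalIntegral.integral_mono_on zero_le_one
    ((continuous_const.mul (continuous_inv_sinh_rFun hε)).intervalIntegrable _ _)
    ((contDiff_rFun hε).continuous.intervalIntegrable _ _) fun t _ => ?_
  have h1 := alpha_le_rFun hε t
  have h2 := alpha_pos hε
  have h3 : Real.sinh (2 * Real.pi * alpha ε) ≤ Real.sinh (2 * Real.pi * rFun ε t) :=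
    Real.sinh_le_sinh.2 (mul_le_mul_of_nonneg_left h1 (by positivity))
  have h4 : 0 < Real.sinh (2 * Real.pi * alpha ε) := Real.sinh_pos_iff.2 (by positivity)
  rw [mul_one_div, div_le_iff₀ (sinh_rFun_pos hε t), ratioBound]
  exact mul_le_mul h1 h3 h4.le (h2.le.trans h1)

/-- The integrands of `perAtilde` and `perA` have ratio `u sinh (2πu)` with `u = s(t + 1/2)`, and `0
< u < α` inside the interval. -/
theorem perAtilde_lt {ε : ℝ} (hε : 4 < ε) : perAtilde ε < ratioBound ε * perA ε := by
  rw [perA_eq hε, perAtilde, mul_left_comm]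
  refine mul_lt_mul_of_pos_left ?_ (by norm_num)
  have hprod : Continuous fun t => sFun ε (t + 1 / 2) * deriv (sFun ε) t :=
    ((continuous_sFun ε).comp (by fun_prop)).mul (continuous_deriv_sFun ε)
  have hden := continuous_ovalDensity ε
  have hpi := Real.pi_pos
  have hα := alpha_pos hε
  have hden2 : Continuous fun t => ratioBound ε * ovalDensity ε t := continuous_const.mul hden
  rw [← intervalIntegral.integral_const_mul, ← sub_pos, ← intervalIntegral.integral_sub
    (hden2.intervalIntegrable _ _) (hprod.intervalIntegrable _ _)]
  refine intervalIntegral.intervalIntegral_pos_of_pos_on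
    ((hden2.sub hprod).intervalIntegrable _ _) (fun t ht => ?_) (by norm_num)
  have hcos := cos_pi_mul_pos ht
  have hsinh := sinh_pi_alpha_pos hε
  have hcos1 : Real.cos (Real.pi * t) < 1 := by
    rw [← Real.cos_zero]
    exact Real.cos_lt_cos_of_nonneg_of_le_pi le_rfl (by nlinarith [ht.2]) (by nlinarith [ht.1])
  have hu0 : 0 < sFun ε (t + 1 / 2) := by
    have : 0 < Real.sinh (Real.pi * sFun ε (t + 1 / 2)) := by
      rw [sinh_sFun_add_half]
      positivity
    exact pos_of_mul_pos_right (Real.sinh_pos_iff.1 this) hpi.le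
  have hu1 : sFun ε (t + 1 / 2) < alpha ε := by
    have : Real.sinh (Real.pi * sFun ε (t + 1 / 2)) < Real.sinh (Real.pi * alpha ε) := by
      rw [sinh_sFun_add_half]
      nlinarith
    exact lt_of_mul_lt_mul_left (Real.sinh_lt_sinh.1 this) hpi.le
  have hs0 : 0 < Real.sinh (2 * Real.pi * sFun ε (t + 1 / 2)) :=
    Real.sinh_pos_iff.2 (by positivity)
  have hs1 : Real.sinh (2 * Real.pi * sFun ε (t + 1 / 2)) < Real.sinh (2 * Real.pi * alpha ε) :=
    Real.sinh_lt_sinh.2 (mul_lt_mul_of_pos_left hu1 (by positivity))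
  have hd : 0 < deriv (sFun ε) t := by
    rw [deriv_sFun]
    have := Real.cosh_pos (Real.pi * sFun ε t)
    positivity
  rw [sub_pos, ← deriv_sFun_div hε hcos.ne', mul_div_assoc', lt_div_iff₀ hs0, ratioBound]
  have : sFun ε (t + 1 / 2) * Real.sinh (2 * Real.pi * sFun ε (t + 1 / 2)) <
      alpha ε * Real.sinh (2 * Real.pi * alpha ε) := mul_lt_mul'' hu1 hs1 hu0.le hs0.le
  nlinarith

/-! ### Quantization conditions -/

theorem exists_eq_intCast_of_exp_eq_one {w : ℂ}
    (h : Complex.exp (2 * Real.pi * Complex.I * w) = 1) : ∃ n : ℤ, w = n := by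
  obtain ⟨n, hn⟩ := Complex.exp_eq_one_iff.1 h
  refine ⟨n, mul_left_cancel₀ Complex.two_pi_I_ne_zero ?_⟩
  rw [hn, mul_comm]

theorem sin_two_pi_mul_add_int (z : ℂ) (n : ℤ) :
    Complex.sin (2 * Real.pi * (z + n)) = Complex.sin (2 * Real.pi * z) := by
  rw [mul_add, mul_comm (2 * Real.pi : ℂ) n, Complex.sin_add_int_mul_two_pi]

theorem sin_two_pi_mul_neg (z : ℂ) :
    Complex.sin (2 * Real.pi * -z) = -Complex.sin (2 * Real.pi * z) := by
  rw [mul_neg, Complex.sin_neg]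

theorem exists_two_mul_eq_of_sin_eq_zero {z : ℂ} (h : Complex.sin (2 * Real.pi * z) = 0) :
    ∃ k : ℤ, z = -z + k := by
  obtain ⟨k, hk⟩ := Complex.sin_eq_zero_iff.1 h
  refine ⟨k, mul_left_cancel₀ (Complex.ofReal_ne_zero.2 Real.pi_ne_zero) ?_⟩
  linear_combination hk

theorem sin_eq_zero_of_two_mul_eq {z : ℂ} {k : ℤ} (h : z = -z + k) :
    Complex.sin (2 * Real.pi * z) = 0 :=
  Complex.sin_eq_zero_iff.2 ⟨k, by linear_combination (Real.pi : ℂ) * h⟩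

namespace SpectralEquations

variable {lam : ℂ} {ε : ℝ}

theorem exists_perA_eq (hspec : SpectralEquations lam ε (basePoint ε)) (hε : 4 < ε) :
    ∃ m : ℤ, (perA ε : ℂ) * lam - perAtilde ε = m := by
  obtain ⟨γ, hγ, hw⟩ := isIntegralValue_oval hε lam
  exact exists_eq_intCast_of_exp_eq_one (hw ▸ hspec _ γ hγ rfl rfl)

theorem exists_perB_eq (hspec : SpectralEquations lam ε (basePoint ε)) (hε : 4 < ε) :
    ∃ m : ℤ, Complex.I * (perBtilde ε - lam * perB ε) = m := by
  obtain ⟨γ, hγ, hw⟩ := isIntegralValue_add_one hε lam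
  refine exists_eq_intCast_of_exp_eq_one (hw ▸ hspec _ γ hγ rfl ?_)
  simp [expMap, basePoint, Complex.exp_two_pi_mul_I]

/-- The oval condition makes `lam` real, so the integer `i(B̃ - λB)` has real part zero. -/
theorem perBtilde_eq (hspec : SpectralEquations lam ε (basePoint ε)) (hε : 4 < ε) :
    (perBtilde ε : ℂ) = lam * perB ε := by
  obtain ⟨m, hm⟩ := hspec.exists_perA_eq hε
  obtain ⟨k, hk⟩ := hspec.exists_perB_eq hε
  have hA : (perA ε : ℂ) ≠ 0 := Complex.ofReal_ne_zero.2 (perA_pos hε).ne'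
  have hlam : lam = (((m + perAtilde ε) / perA ε : ℝ) : ℂ) := by
    push_cast
    rw [eq_div_iff hA]
    linear_combination hm
  have hk0 : (k : ℝ) = 0 := by
    have := congrArg Complex.re hk
    rw [hlam] at this
    simpa using this.symm
  have hk1 : (k : ℂ) = 0 := by exact_mod_cast hk0
  rw [hk1, mul_eq_zero, or_iff_right Complex.I_ne_zero, sub_eq_zero] at hk
  exact hk

theorem eq_div (hspec : SpectralEquations lam ε (basePoint ε)) (hε : 4 < ε) :
    lam = (perBtilde ε : ℂ) / perB ε := by
  rw [eq_div_iff (Complex.ofReal_ne_zero.2 (perB_pos hε).ne'), hspec.perBtilde_eq hε]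

theorem ne_zero (hspec : SpectralEquations lam ε (basePoint ε)) (hε : 4 < ε) : lam ≠ 0 := by
  rintro rfl
  have h1 := hspec.perBtilde_eq hε
  rw [zero_mul, Complex.ofReal_eq_zero] at h1
  have := mul_pos (ratioBound_pos hε) (perB_pos hε)
  linarith [ratioBound_mul_perB_le hε]

theorem exists_quantum_number (hspec : SpectralEquations lam ε (basePoint ε)) (hε : 4 < ε) :
    ∃ n : ℕ, (perA ε : ℂ) * lam - perAtilde ε = (n : ℂ) + 1 ∧
      perA ε * perBtilde ε - perB ε * perAtilde ε = ((n : ℝ) + 1) * perB ε := by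
  obtain ⟨m, hm⟩ := hspec.exists_perA_eq hε
  have hB := perB_pos hε
  have h1 : perA ε * perBtilde ε - perB ε * perAtilde ε = m * perB ε := by
    have : (perA ε * perBtilde ε - perB ε * perAtilde ε : ℂ) = m * perB ε := by
      rw [hspec.perBtilde_eq hε]
      linear_combination (perB ε : ℂ) * hm
    exact_mod_cast this
  -- Both terms are compared with `ratioBound ε * perA ε * perB ε`.
  have h2 : 0 < perA ε * perBtilde ε - perB ε * perAtilde ε := by
    have h3 := mul_le_mul_of_nonneg_left (ratioBound_mul_perB_le hε) (perA_pos hε).le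
    have h4 := mul_lt_mul_of_pos_left (perAtilde_lt hε) hB
    linarith
  have hm0 : 0 < m := by
    rw [h1] at h2
    exact_mod_cast pos_of_mul_pos_left h2 hB.le
  obtain ⟨n, rfl⟩ : ∃ n : ℕ, m = n + 1 := ⟨(m - 1).toNat, by omega⟩
  exact ⟨n, by simpa using hm, by simpa using h1⟩

end SpectralEquations

/-! ### Connectedness of the curve -/

theorem exists_mem_spectralCurve (ε : ℝ) (x : ℂ) : ∃ y : ℂ, (x, y) ∈ spectralCurve ε := by
  obtain ⟨z, hz⟩ := Complex.cos_surjective ((ε : ℂ) / 2 - Complex.cos (2 * Real.pi * x))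
  refine ⟨z / (2 * Real.pi), ?_⟩
  rw [mem_spectralCurve]
  simp only
  rw [mul_div_cancel₀ _ two_pi_ne_zero', hz]
  ring

theorem eq_add_or_eq_neg_add {ε : ℝ} {x y y' : ℂ} (h : (x, y) ∈ spectralCurve ε)
    (h' : (x, y') ∈ spectralCurve ε) : ∃ k : ℤ, y' = y + k ∨ y' = -y + k := by
  rw [mem_spectralCurve] at h h'
  have hc : Complex.cos (2 * Real.pi * y) = Complex.cos (2 * Real.pi * y') := by
    linear_combination h - h'
  obtain ⟨k, hk | hk⟩ := Complex.cos_eq_cos_iff.1 hc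
  · exact ⟨k, Or.inl (mul_left_cancel₀ two_pi_ne_zero' (by linear_combination hk))⟩
  · exact ⟨k, Or.inr (mul_left_cancel₀ two_pi_ne_zero' (by linear_combination hk))⟩

/-- `w` is a value at `(x, y)` of the integral from the base point. -/
def IsAction (lam : ℂ) (ε : ℝ) (x y w : ℂ) : Prop :=
  IsIntegralValue lam ε (basePoint ε) (x, y) w

namespace IsAction

variable {lam : ℂ} {ε : ℝ} {x y w x' y' w' : ℂ}

theorem mem (h : IsAction lam ε x y w) : (x, y) ∈ spectralCurve ε := h.target_mem

theorem neg_snd (hε : 4 < ε) (h : IsAction lam ε x y w) : IsAction lam ε x (-y) (-w) := by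
  have := IsIntegralValue.neg_snd hε h
  rwa [neg_zero] at this

theorem trans (hε : 4 < ε) (h : IsAction lam ε x y w)
    (h' : IsIntegralValue lam ε (x, y) (x', y') w') : IsAction lam ε x' y' (w + w') :=
  IsIntegralValue.trans hε h h'

/-- The path from `P₀` to `P₀ + (0, 1)` has integral zero because `B̃ = λB`; it is followed by the
translate of the given path. -/
theorem add_one_snd (hε : 4 < ε) (hspec : SpectralEquations lam ε (basePoint ε))
    (h : IsAction lam ε x y w) : IsAction lam ε x (y + 1) w := by
  have h1 : IsAction lam ε (Complex.I * alpha ε) 1 0 := by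
    have := isIntegralValue_add_one hε lam
    rwa [hspec.perBtilde_eq hε, sub_self, mul_zero] at this
  have h2 := IsIntegralValue.add_one_snd hε h
  rw [zero_add] at h2
  simpa using h1.trans hε h2

theorem add_int_snd (hε : 4 < ε) (hspec : SpectralEquations lam ε (basePoint ε))
    (h : IsAction lam ε x y w) (k : ℤ) : IsAction lam ε x (y + k) w := by
  induction k using Int.induction_on with
  | zero => simpa using h
  | succ k ih =>
    have := ih.add_one_snd hε hspec
    push_cast at this ⊢
    rwa [add_assoc] at this
  | pred k ih =>
    have := ((ih.neg_snd hε).add_one_snd hε hspec).neg_snd hε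
    push_cast at this ⊢
    rw [neg_neg] at this
    convert this using 1
    ring

theorem exists_of_mem (hε : 4 < ε) (hspec : SpectralEquations lam ε (basePoint ε))
    (h : IsAction lam ε x y w) (h' : (x, y') ∈ spectralCurve ε) :
    ∃ k : ℤ, (y' = y + k ∧ IsAction lam ε x y' w) ∨ (y' = -y + k ∧ IsAction lam ε x y' (-w)) := by
  obtain ⟨k, rfl | rfl⟩ := eq_add_or_eq_neg_add h.mem h'
  · exact ⟨k, Or.inl ⟨rfl, h.add_int_snd hε hspec k⟩⟩
  · exact ⟨k, Or.inr ⟨rfl, (h.neg_snd hε).add_int_snd hε hspec k⟩⟩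

theorem eq_add_int (hε : 4 < ε) (hspec : SpectralEquations lam ε (basePoint ε))
    (h : IsAction lam ε x y w) (h' : IsAction lam ε x y w') : ∃ n : ℤ, w' = w + n := by
  obtain ⟨γ, hγ, hw⟩ := IsIntegralValue.trans hε h' (IsIntegralValue.symm h)
  obtain ⟨n, hn⟩ := exists_eq_intCast_of_exp_eq_one (hw ▸ hspec _ γ hγ rfl rfl)
  exact ⟨n, by linear_combination hn⟩

end IsAction

theorem basePoint_mem {ε : ℝ} (hε : 4 < ε) : basePoint ε ∈ spectralCurve ε :=
  (isIntegralValue_oval hε 0).source_mem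

/-- Every point of the curve can be joined to the base point. -/
theorem exists_isAction {lam : ℂ} {ε : ℝ} (hε : 4 < ε)
    (hspec : SpectralEquations lam ε (basePoint ε)) {x y : ℂ} (hmem : (x, y) ∈ spectralCurve ε) :
    ∃ w, IsAction lam ε x y w := by
  -- Connectedness of the `x`-plane is used. If one point over `x` is reachable then all are, so a
  -- chart around any point over a limit of `S` leads back to a reachable point.
  let S : Set ℂ := {x | ∃ y w, IsAction lam ε x y w}
  have hreach : ∀ x ∈ S, ∀ y, (x, y) ∈ spectralCurve ε → ∃ w, IsAction lam ε x y w := by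
    rintro x ⟨y, w, h⟩ y' hy'
    obtain ⟨k, ⟨-, h1⟩ | ⟨-, h1⟩⟩ := h.exists_of_mem hε hspec hy'
    · exact ⟨_, h1⟩
    · exact ⟨_, h1⟩
  have hopen : IsOpen S := by
    rw [isOpen_iff_mem_nhds]
    rintro x ⟨y, w, h⟩
    filter_upwards [eventually_exists_isIntegralValue hε lam h.mem]
    rintro x' ⟨y', w', h'⟩
    exact ⟨y', w + w', h.trans hε h'⟩
  have hclosed : IsClosed S := by
    rw [← isOpen_compl_iff, isOpen_iff_mem_nhds]
    intro x hx
    obtain ⟨y, hy⟩ := exists_mem_spectralCurve ε x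
    filter_upwards [eventually_exists_isIntegralValue hε lam hy]
    rintro x' ⟨y', w', h'⟩ hx'
    obtain ⟨w, hw⟩ := hreach x' hx' y' h'.target_mem
    exact hx ⟨y, w + -w', hw.trans hε h'.symm⟩
  have huniv : S = univ := by
    refine IsClopen.eq_univ ⟨hclosed, hopen⟩ ⟨Complex.I * alpha ε, 0, _, isIntegralValue_oval hε lam⟩
  exact hreach x (huniv ▸ mem_univ x) y hmem

theorem IsAction.exists_eq {lam : ℂ} {ε : ℝ} (hε : 4 < ε)
    (hspec : SpectralEquations lam ε (basePoint ε)) {x y y' w w' : ℂ} (h : IsAction lam ε x y w)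
    (h' : IsAction lam ε x y' w') :
    ∃ k n : ℤ, (y' = y + k ∧ w' = w + n) ∨ (y' = -y + k ∧ w' = -w + n) := by
  obtain ⟨k, ⟨hy, h1⟩ | ⟨hy, h1⟩⟩ := h.exists_of_mem hε hspec h'.mem
  · obtain ⟨n, hn⟩ := h1.eq_add_int hε hspec h'
    exact ⟨k, n, Or.inl ⟨hy, hn⟩⟩
  · obtain ⟨n, hn⟩ := h1.eq_add_int hε hspec h'
    exact ⟨k, n, Or.inr ⟨hy, hn⟩⟩

/-- A function of `y` and of the integral that is invariant under the symmetries is a function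
of `x`. -/
theorem exists_descend {lam : ℂ} {ε : ℝ} (hε : 4 < ε)
    (hspec : SpectralEquations lam ε (basePoint ε)) {β : Type*} (Φ : ℂ → ℂ → β)
    (hadd : ∀ y w (k n : ℤ), Φ (y + k) (w + n) = Φ y w) (hneg : ∀ y w, Φ (-y) (-w) = Φ y w) :
    ∃ f : ℂ → β, ∀ x y w, IsAction lam ε x y w → f x = Φ y w := by
  have h : ∀ x, ∃ y w, IsAction lam ε x y w := fun x => by
    obtain ⟨y, hy⟩ := exists_mem_spectralCurve ε x
    exact ⟨y, exists_isAction hε hspec hy⟩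
  choose Y W hYW using h
  refine ⟨fun x => Φ (Y x) (W x), fun x y w hw => ?_⟩
  obtain ⟨k, n, ⟨h1, h2⟩ | ⟨h1, h2⟩⟩ := hw.exists_eq hε hspec (hYW x)
  · simp only [h1, h2, hadd]
  · simp only [h1, h2, hadd, hneg]

/-! ### Action values under translation and reflection of `x`, and at the branch points -/

/-- `P₀` is joined to `P₀ + (1, 0)` by going to `(0, iα)`, across to `(1, iα)` along the exchanged
real path, and back along the translate of the first piece. The contributions `q`, `iα` and `-(q +
iα)` cancel; the translate of the given path then adds `w + y`. -/
theorem IsAction.add_one_fst {lam : ℂ} {ε : ℝ} (hε : 4 < ε)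
    (hspec : SpectralEquations lam ε (basePoint ε)) {x y w : ℂ} (h : IsAction lam ε x y w) :
    IsAction lam ε (x + 1) y (w + y) := by
  have hmem : ((0 : ℂ), Complex.I * (alpha ε : ℂ)) ∈ spectralCurve ε := by
    have := basePoint_mem hε
    rw [mem_spectralCurve] at this ⊢
    rw [← this, add_comm]
    rfl
  obtain ⟨q, hq⟩ := exists_isAction hε hspec hmem
  have h1 : IsIntegralValue lam ε (0, Complex.I * alpha ε) (1, Complex.I * alpha ε)
      (Complex.I * alpha ε) := by
    have := (isIntegralValue_add_one hε lam).swap hε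
    rw [hspec.perBtilde_eq hε, sub_self, mul_zero] at this
    simpa using this
  have h2 := IsIntegralValue.add_one_fst hε hq
  have h3 := IsIntegralValue.add_one_fst hε h
  rw [zero_add] at h2
  have h4 := ((hq.trans hε h1).trans hε h2.symm).trans hε h3
  convert h4 using 1
  ring

/-- Here `y = -y + k` with `k` an integer, so `w` and `-w` are action values at the same point and
`2w` is an integer. -/
theorem IsAction.sin_eq_zero {lam : ℂ} {ε : ℝ} (hε : 4 < ε)
    (hspec : SpectralEquations lam ε (basePoint ε)) {x y w : ℂ} (h : IsAction lam ε x y w)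
    (hy : Complex.sin (2 * Real.pi * y) = 0) : Complex.sin (2 * Real.pi * w) = 0 := by
  obtain ⟨k, hk⟩ := exists_two_mul_eq_of_sin_eq_zero hy
  have h1 := (h.neg_snd hε).add_int_snd hε hspec k
  rw [← hk] at h1
  obtain ⟨n, hn⟩ := h1.eq_add_int hε hspec h
  exact sin_eq_zero_of_two_mul_eq hn

/-- `κ` is an action value at the reflected base point `(-iα, 0)`, from which the reflected path
starts; there `y = 0`. -/
theorem IsAction.exists_neg_fst {lam : ℂ} {ε : ℝ} (hε : 4 < ε)
    (hspec : SpectralEquations lam ε (basePoint ε)) :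
    ∃ κ : ℂ, Complex.sin (2 * Real.pi * κ) = 0 ∧ ∀ x y w, IsAction lam ε x y w →
      IsAction lam ε (-x) y (κ - w) := by
  have hmem : (-(Complex.I * (alpha ε : ℂ)), (0 : ℂ)) ∈ spectralCurve ε := by
    have := basePoint_mem hε
    rw [mem_spectralCurve] at this ⊢
    rw [← this]
    simp [basePoint]
  obtain ⟨κ, hκ⟩ := exists_isAction hε hspec hmem
  refine ⟨κ, hκ.sin_eq_zero hε hspec (by simp), fun x y w h => ?_⟩
  exact hκ.trans hε (IsIntegralValue.neg_fst hε h)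

/-! ### The entire solution -/

/-- `f` is the quotient of `sin (2π ∫ θ)` by `sin (2πy)`, as a function of `x`. -/
def IsSinQuotient (lam : ℂ) (ε : ℝ) (f : ℂ → ℂ) : Prop :=
  ∀ x y w, IsAction lam ε x y w →
    f x = Complex.sin (2 * Real.pi * w) / Complex.sin (2 * Real.pi * y)

theorem exists_isSinQuotient {lam : ℂ} {ε : ℝ} (hε : 4 < ε)
    (hspec : SpectralEquations lam ε (basePoint ε)) : ∃ f, IsSinQuotient lam ε f :=
  exists_descend hε hspec
    (fun y w => Complex.sin (2 * Real.pi * w) / Complex.sin (2 * Real.pi * y))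
    (fun y w k n => by rw [sin_two_pi_mul_add_int, sin_two_pi_mul_add_int])
    (fun y w => by rw [sin_two_pi_mul_neg, sin_two_pi_mul_neg, neg_div_neg_eq])

theorem sin_sq_eq_of_mem {ε : ℝ} {x y : ℂ} (h : (x, y) ∈ spectralCurve ε) :
    Complex.sin (2 * Real.pi * y) ^ 2 =
      1 - ((ε : ℂ) / 2 - Complex.cos (2 * Real.pi * x)) ^ 2 := by
  rw [mem_spectralCurve] at h
  simp only at h
  rw [Complex.sin_sq, ← h]
  ring

theorem IsSinQuotient.differentiableAt {lam : ℂ} {ε : ℝ} (hε : 4 < ε) {f : ℂ → ℂ}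
    (hf : IsSinQuotient lam ε f) {x y w : ℂ} (h : IsAction lam ε x y w)
    (hy : Complex.sin (2 * Real.pi * y) ≠ 0) : DifferentiableAt ℂ f x := by
  obtain ⟨r, hr, Y, G, hY0, hG0, hYd, hY⟩ := exists_chart_fst hε lam h.mem hy
  have hx : x ∈ Metric.ball x r := Metric.mem_ball_self hr
  have hYx := hYd.differentiableAt (Metric.ball_mem_nhds x hr)
  have hGx := (hY x hx).2.2.1.differentiableAt
  have heq : f =ᶠ[𝓝 x] fun u =>
      Complex.sin (2 * Real.pi * (w + G u)) / Complex.sin (2 * Real.pi * Y u) := by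
    filter_upwards [Metric.ball_mem_nhds x hr] with u hu
    exact hf u _ _ (h.trans hε (hY u hu).2.2.2)
  refine DifferentiableAt.congr_of_eventuallyEq ?_ heq
  exact (((hGx.const_add w).const_mul _).csin).div ((hYx.const_mul _).csin) (hY x hx).1

/-- `sin² (2πy)` is a function of `x` alone, and its zeros are simple because `sin (2πx) ≠ 0` at
them. -/
theorem eventually_sin_ne_zero {ε : ℝ} (hε : 4 < ε) {x₀ y₀ : ℂ}
    (hmem : (x₀, y₀) ∈ spectralCurve ε) :
    ∀ᶠ x in 𝓝[≠] x₀, ∀ y, (x, y) ∈ spectralCurve ε → Complex.sin (2 * Real.pi * y) ≠ 0 := by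
  have hd : HasDerivAt (fun x : ℂ => 1 - ((ε : ℂ) / 2 - Complex.cos (2 * Real.pi * x)) ^ 2)
      (-(2 * ((ε : ℂ) / 2 - Complex.cos (2 * Real.pi * x₀)) *
        (2 * Real.pi * Complex.sin (2 * Real.pi * x₀)))) x₀ := by
    have := (((hasDerivAt_cos_two_pi x₀).const_sub ((ε : ℂ) / 2)).pow 2).const_sub 1
    refine this.congr_deriv ?_
    push_cast
    ring
  by_cases hs : Complex.sin (2 * Real.pi * y₀) = 0
  · have hx : Complex.sin (2 * Real.pi * x₀) ≠ 0 := fun h =>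
      sin_ne_zero_of_sin_eq_zero hε hmem h hs
    have hc : (ε : ℂ) / 2 - Complex.cos (2 * Real.pi * x₀) ≠ 0 := fun h => by
      have := sin_sq_eq_of_mem hmem
      rw [hs, h] at this
      norm_num at this
    have hne := hd.eventually_ne (c := 0) (neg_ne_zero.2 (mul_ne_zero (mul_ne_zero two_ne_zero hc)
      (mul_ne_zero two_pi_ne_zero' hx)))
    filter_upwards [hne] with x hx y hy h0
    rw [← sin_sq_eq_of_mem hy, h0] at hx
    simp at hx
  · have hne := hd.continuousAt.eventually_ne (y := 0) (by
      rw [← sin_sq_eq_of_mem hmem]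
      exact pow_ne_zero 2 hs)
    filter_upwards [nhdsWithin_le_nhds hne] with x hx y hy h0
    rw [← sin_sq_eq_of_mem hy, h0] at hx
    simp at hx

/-- At a branch point `y` is a coordinate: `sin (2πw)` vanishes at `y₀` and `sin (2πy)` has a simple
zero there. The bound in `y` passes to `x` because `X` is open. -/
theorem IsSinQuotient.eventually_norm_le {lam : ℂ} {ε : ℝ} (hε : 4 < ε)
    (hspec : SpectralEquations lam ε (basePoint ε)) {f : ℂ → ℂ} (hf : IsSinQuotient lam ε f)
    {x₀ y₀ : ℂ} (hmem : (x₀, y₀) ∈ spectralCurve ε) (hy₀ : Complex.sin (2 * Real.pi * y₀) = 0) :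
    ∃ C, ∀ᶠ x in 𝓝 x₀, ‖f x‖ ≤ C := by
  have hx₀ : Complex.sin (2 * Real.pi * x₀) ≠ 0 := fun h =>
    sin_ne_zero_of_sin_eq_zero hε hmem h hy₀
  obtain ⟨w, hw⟩ := exists_isAction hε hspec hmem
  obtain ⟨r, hr, X, G, hX0, hG0, hXd, hX⟩ := exists_chart_snd lam hmem hx₀
  have hGd := (hX y₀ (Metric.mem_ball_self hr)).2.2.1.differentiableAt
  have hN : DifferentiableAt ℂ (fun y => Complex.sin (2 * Real.pi * (w + G y))) y₀ :=
    ((hGd.const_add w).const_mul _).csin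
  have hN0 : Complex.sin (2 * Real.pi * (w + G y₀)) = 0 := by
    rw [hG0, add_zero]
    exact hw.sin_eq_zero hε hspec hy₀
  have hc : 2 * Real.pi * Complex.cos (2 * Real.pi * y₀) ≠ 0 := by
    refine mul_ne_zero two_pi_ne_zero' fun h => ?_
    have := Complex.sin_sq_add_cos_sq (2 * Real.pi * y₀)
    rw [hy₀, h] at this
    norm_num at this
  have h1 := hN.hasDerivAt.isBigO_sub.trans
    ((HasDerivAtFilter.isTheta_sub (hasDerivAt_sin_two_pi y₀) hc).isBigO_symm.comp_tendsto
      (tendsto_id.prodMk tendsto_const_pure))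
  simp only [hN0, sub_zero, Function.comp_def, id, hy₀] at h1
  obtain ⟨C, hC⟩ := h1.bound
  refine ⟨max C 0, ?_⟩
  have hle := nhds_le_map_of_chart hr hXd fun y hy => (hX y hy).2.1
  rw [hX0] at hle
  refine hle (mem_map.2 ?_)
  filter_upwards [hC, Metric.ball_mem_nhds y₀ hr] with y hy hyr
  rw [mem_preimage, mem_ofPred_eq, hf _ _ _ (hw.trans hε (hX y hyr).2.2.2), norm_div]
  refine div_le_of_le_mul₀ (norm_nonneg _) (le_max_right _ _) (hy.trans ?_)
  gcongr
  exact le_max_left _ _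

/-- The entire extension of a function with removable singularities. -/
noncomputable def entireExtension (f : ℂ → ℂ) (x : ℂ) : ℂ := limUnder (𝓝[≠] x) f

theorem entireExtension_eq {f : ℂ → ℂ} {x : ℂ} (h : ContinuousAt f x) :
    entireExtension f x = f x :=
  (h.tendsto.mono_left nhdsWithin_le_nhds).limUnder_eq

theorem IsSinQuotient.differentiable {lam : ℂ} {ε : ℝ} (hε : 4 < ε)
    (hspec : SpectralEquations lam ε (basePoint ε)) {f : ℂ → ℂ} (hf : IsSinQuotient lam ε f) :
    Differentiable ℂ (entireExtension f) := by
  have hnon : ∀ x, (∀ y, (x, y) ∈ spectralCurve ε → Complex.sin (2 * Real.pi * y) ≠ 0) →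
      DifferentiableAt ℂ f x := fun x hx => by
    obtain ⟨y, hy⟩ := exists_mem_spectralCurve ε x
    obtain ⟨w, hw⟩ := exists_isAction hε hspec hy
    exact hf.differentiableAt hε hw (hx y hy)
  intro x₀
  obtain ⟨y₀, hmem⟩ := exists_mem_spectralCurve ε x₀
  have hev := eventually_sin_ne_zero hε hmem
  have hb : ∃ C, ∀ᶠ x in 𝓝 x₀, ‖f x‖ ≤ C := by
    by_cases hs : Complex.sin (2 * Real.pi * y₀) = 0
    · exact hf.eventually_norm_le hε hspec hmem hs
    · obtain ⟨w, hw⟩ := exists_isAction hε hspec hmem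
      exact ⟨‖f x₀‖ + 1, ((hf.differentiableAt hε hw hs).continuousAt.norm.eventually_lt_const
        (lt_add_one _)).mono fun x hx => hx.le⟩
  obtain ⟨C, hC⟩ := hb
  rw [eventually_nhdsWithin_iff] at hev
  let s : Set ℂ := {x | (x ∈ ({x₀}ᶜ : Set ℂ) → ∀ y, (x, y) ∈ spectralCurve ε →
    Complex.sin (2 * Real.pi * y) ≠ 0) ∧ ‖f x‖ ≤ C}
  have hs : s ∈ 𝓝 x₀ := hev.and hC
  have hd : DifferentiableOn ℂ f (s \ {x₀}) := fun x hx =>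
    (hnon x (hx.1.1 hx.2)).differentiableWithinAt
  -- Riemann's removable singularity theorem; away from `x₀` the extension is `f` itself.
  have hupd := Complex.differentiableOn_update_limUnder_of_bddAbove hs hd
    ⟨C, by rintro _ ⟨x, hx, rfl⟩; exact hx.1.2⟩
  refine (hupd.differentiableAt hs).congr_of_eventuallyEq ?_
  filter_upwards [hs] with x hx
  by_cases h : x = x₀
  · subst h
    simp [entireExtension]
  · rw [Function.update_of_ne h, entireExtension_eq (hnon x (hx.1 h)).continuousAt]

theorem IsSinQuotient.sin_mul {lam : ℂ} {ε : ℝ} (hε : 4 < ε)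
    (hspec : SpectralEquations lam ε (basePoint ε)) {f : ℂ → ℂ} (hf : IsSinQuotient lam ε f)
    {x y w : ℂ} (h : IsAction lam ε x y w) :
    Complex.sin (2 * Real.pi * y) * entireExtension f x = Complex.sin (2 * Real.pi * w) := by
  by_cases hs : Complex.sin (2 * Real.pi * y) = 0
  · rw [hs, zero_mul, h.sin_eq_zero hε hspec hs]
  · rw [entireExtension_eq (hf.differentiableAt hε h hs).continuousAt, hf x y w h,
      mul_div_cancel₀ _ hs]

theorem IsSinQuotient.difference_equation {lam : ℂ} {ε : ℝ} (hε : 4 < ε)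
    (hspec : SpectralEquations lam ε (basePoint ε)) {f : ℂ → ℂ} (hf : IsSinQuotient lam ε f)
    (x : ℂ) : entireExtension f (x - 1) + entireExtension f (x + 1) +
      (2 * Complex.cos (2 * Real.pi * x) - ε) * entireExtension f x = 0 := by
  set φ := entireExtension f with hφ
  have hcont : Continuous φ := (hf.differentiable hε hspec).continuous
  obtain ⟨y₀, hmem⟩ := exists_mem_spectralCurve ε x
  have hzero : ∀ᶠ u in 𝓝[≠] x, φ (u - 1) + φ (u + 1) +
      (2 * Complex.cos (2 * Real.pi * u) - ε) * φ u = 0 := by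
    filter_upwards [eventually_sin_ne_zero hε hmem] with u hu
    obtain ⟨y, hy⟩ := exists_mem_spectralCurve ε u
    obtain ⟨w, hw⟩ := exists_isAction hε hspec hy
    have hy' : (u - 1, y) ∈ spectralCurve ε := by
      rw [mem_spectralCurve] at hy ⊢
      rw [← hy]
      simp only
      rw [← cos_two_pi_mul_add_one (u - 1), sub_add_cancel]
    obtain ⟨w', hw'⟩ := exists_isAction hε hspec hy'
    have h1 := hf.sin_mul hε hspec hw
    have h2 := hf.sin_mul hε hspec (hw.add_one_fst hε hspec)
    have h3 := hf.sin_mul hε hspec hw'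
    have h4 := hw'.add_one_fst hε hspec
    rw [sub_add_cancel] at h4
    obtain ⟨n, hn⟩ := hw.eq_add_int hε hspec h4
    -- Translating back from `u - 1` to `u` shows that `w' + y` and `w` are action values at the
    -- same point.
    rw [show w' = w - y + n by linear_combination hn, sin_two_pi_mul_add_int, mul_sub,
      Complex.sin_sub] at h3
    rw [mul_add, Complex.sin_add] at h2
    rw [mem_spectralCurve] at hy
    simp only at hy
    apply mul_left_cancel₀ (hu y hy)
    rw [← hφ] at h1 h2 h3
    linear_combination h2 + h3 - 2 * Complex.cos (2 * Real.pi * y) * h1 +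
      2 * Complex.sin (2 * Real.pi * y) * φ u * hy
  have hcos : Continuous fun u : ℂ => Complex.cos (2 * Real.pi * u) :=
    Complex.continuous_cos.comp (by fun_prop)
  have hΦ : Continuous fun u => φ (u - 1) + φ (u + 1) +
      (2 * Complex.cos (2 * Real.pi * u) - ε) * φ u := by fun_prop
  exact tendsto_nhds_unique ((hΦ.tendsto x).mono_left nhdsWithin_le_nhds)
    (tendsto_const_nhds.congr' (hzero.mono fun _ h => h.symm))

/-- If `φ` vanished on the imaginary axis, so would `sin (2πw)` near `(0, iα)`. Its derivative there
is a nonzero multiple of `cos (2πw) * lam`, and neither factor is zero. -/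
theorem IsSinQuotient.exists_ne_zero {lam : ℂ} {ε : ℝ} (hε : 4 < ε)
    (hspec : SpectralEquations lam ε (basePoint ε)) {f : ℂ → ℂ} (hf : IsSinQuotient lam ε f) :
    ∃ u : ℝ, entireExtension f (Complex.I * u) ≠ 0 := by
  by_contra! hzero
  have hmem : ((0 : ℂ), Complex.I * (alpha ε : ℂ)) ∈ spectralCurve ε := by
    have := basePoint_mem hε
    rw [mem_spectralCurve] at this ⊢
    rw [← this, add_comm]
    rfl
  have hs : Complex.sin (2 * Real.pi * (Complex.I * (alpha ε : ℂ))) ≠ 0 :=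
    sin_ne_zero_of_sin_eq_zero hε hmem (by simp)
  obtain ⟨w, hw⟩ := exists_isAction hε hspec hmem
  obtain ⟨r, hr, Y, G, hY0, hG0, hYd, hY⟩ := exists_chart_fst hε lam hmem hs
  obtain ⟨-, -, hGd, -⟩ := hY 0 (Metric.mem_ball_self hr)
  have hl : HasDerivAt (fun u : ℝ => Complex.I * (u : ℂ)) Complex.I 0 := by
    simpa using (Complex.ofRealCLM.hasDerivAt (x := 0)).const_mul Complex.I
  have hev : ∀ᶠ u : ℝ in 𝓝 0, Complex.sin (2 * Real.pi * (w + G (Complex.I * u))) = 0 := by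
    have hball : Metric.ball (0 : ℂ) r ∈ 𝓝 (Complex.I * ((0 : ℝ) : ℂ)) := by
      simpa using Metric.ball_mem_nhds (0 : ℂ) hr
    filter_upwards [hl.continuousAt.preimage_mem_nhds hball] with u hu
    rw [← hf.sin_mul hε hspec (hw.trans hε (hY _ hu).2.2.2), hzero, mul_zero]
  have hGd' : HasDerivAt G (-lam / Complex.sin (2 * Real.pi * Y 0)) (Complex.I * ((0 : ℝ) : ℂ)) := by
    simpa using hGd
  have h1 := (hasDerivAt_sin_two_pi _).comp (0 : ℝ) ((hGd'.comp (0 : ℝ) hl).const_add w)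
  have h2 := h1.unique ((hasDerivAt_const (0 : ℝ) (0 : ℂ)).congr_of_eventuallyEq hev)
  have h3 := hev.self_of_nhds
  have hcos : Complex.cos (2 * Real.pi * (w + G (Complex.I * ((0 : ℝ) : ℂ)))) ≠ 0 := fun h => by
    have := Complex.sin_sq_add_cos_sq (2 * Real.pi * (w + G (Complex.I * ((0 : ℝ) : ℂ))))
    rw [h3, h] at this
    norm_num at this
  have h4 : -lam / Complex.sin (2 * Real.pi * Y 0) ≠ 0 := by
    rw [hY0]
    exact div_ne_zero (neg_ne_zero.2 (hspec.ne_zero hε)) hs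
  exact mul_ne_zero (mul_ne_zero two_pi_ne_zero' hcos) (mul_ne_zero h4 Complex.I_ne_zero) h2

theorem IsSinQuotient.norm_neg {lam : ℂ} {ε : ℝ} (hε : 4 < ε)
    (hspec : SpectralEquations lam ε (basePoint ε)) {f : ℂ → ℂ} (hf : IsSinQuotient lam ε f)
    (x : ℂ) : ‖f (-x)‖ = ‖f x‖ := by
  obtain ⟨y, hy⟩ := exists_mem_spectralCurve ε x
  obtain ⟨w, hw⟩ := exists_isAction hε hspec hy
  obtain ⟨κ, hκ, hneg⟩ := IsAction.exists_neg_fst hε hspec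
  have hc : ‖Complex.cos (2 * Real.pi * κ)‖ = 1 := by
    have := Complex.sin_sq_add_cos_sq (2 * Real.pi * κ)
    rw [hκ] at this
    have h2 : ‖Complex.cos (2 * Real.pi * κ)‖ ^ 2 = 1 := by
      rw [← norm_pow, show Complex.cos (2 * Real.pi * κ) ^ 2 = 1 by simpa using this, norm_one]
    exact (pow_eq_one_iff_of_nonneg (norm_nonneg _) two_ne_zero).1 h2
  rw [hf _ _ _ hw, hf _ _ _ (hneg x y w hw), norm_div, norm_div, mul_sub, Complex.sin_sub, hκ,
    zero_mul, zero_sub, _root_.norm_neg, norm_mul, hc, one_mul]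

/-! ### Estimates for large imaginary part -/

theorem norm_exp_mul_I (z : ℂ) : ‖Complex.exp (z * Complex.I)‖ = Real.exp (-z.im) := by
  rw [Complex.norm_exp]
  simp

theorem norm_exp_neg_mul_I (z : ℂ) : ‖Complex.exp (-z * Complex.I)‖ = Real.exp z.im := by
  rw [norm_exp_mul_I]
  simp

theorem norm_sin_le_cosh (z : ℂ) : ‖Complex.sin z‖ ≤ Real.cosh z.im := by
  have h := norm_sub_le (Complex.exp (-z * Complex.I)) (Complex.exp (z * Complex.I))
  rw [norm_exp_neg_mul_I, norm_exp_mul_I] at h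
  rw [Complex.sin, norm_div, norm_mul, Complex.norm_I, mul_one, Complex.norm_two, Real.cosh_eq]
  gcongr

theorem norm_cos_le_cosh (z : ℂ) : ‖Complex.cos z‖ ≤ Real.cosh z.im := by
  have h := norm_add_le (Complex.exp (z * Complex.I)) (Complex.exp (-z * Complex.I))
  rw [norm_exp_mul_I, norm_exp_neg_mul_I, add_comm (Real.exp (-z.im))] at h
  rw [Complex.cos, norm_div, Complex.norm_two, Real.cosh_eq]
  gcongr

theorem sinh_le_norm_sin (z : ℂ) : Real.sinh z.im ≤ ‖Complex.sin z‖ := by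
  have h := norm_sub_norm_le (Complex.exp (-z * Complex.I)) (Complex.exp (z * Complex.I))
  rw [norm_exp_neg_mul_I, norm_exp_mul_I] at h
  rw [Complex.sin, norm_div, norm_mul, Complex.norm_I, mul_one, Complex.norm_two, Real.sinh_eq]
  gcongr

theorem norm_sub_one_le_or {q : ℂ} :
    ‖q - 1‖ ≤ ‖q ^ 2 - 1‖ ∨ ‖q + 1‖ ≤ ‖q ^ 2 - 1‖ := by
  have h1 : ‖q ^ 2 - 1‖ = ‖q - 1‖ * ‖q + 1‖ := by
    rw [← norm_mul]
    ring_nf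
  have h2 : 2 ≤ ‖q - 1‖ + ‖q + 1‖ := by
    have := norm_sub_le (q + 1) (q - 1)
    rw [show q + 1 - (q - 1) = 2 by ring, Complex.norm_two] at this
    linarith
  rw [h1]
  by_cases h : 1 ≤ ‖q + 1‖
  · exact Or.inl (le_mul_of_one_le_right (norm_nonneg _) h)
  · exact Or.inr (le_mul_of_one_le_left (norm_nonneg _) (by linarith))

/-- For `q = sin (2πx) / sin (2πy)` only `q² ≈ 1` is known. This bound avoids deciding which of the
two signs `q` is close to. -/
theorem abs_re_mul_le (x q : ℂ) : |(x * q).re| ≤ |x.re| + ‖x‖ * ‖q ^ 2 - 1‖ := by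
  rcases norm_sub_one_le_or (q := q) with h | h
  · have h1 : (x * q).re = x.re + (x * (q - 1)).re := by
      rw [← Complex.add_re]
      ring_nf
    rw [h1]
    refine (abs_add_le _ _).trans ?_
    gcongr
    refine (Complex.abs_re_le_norm _).trans ?_
    rw [norm_mul]
    gcongr
  · have h1 : (x * q).re = -x.re + (x * (q + 1)).re := by
      rw [← Complex.neg_re, ← Complex.add_re]
      ring_nf
    rw [h1]
    refine (abs_add_le _ _).trans ?_
    rw [abs_neg]
    gcongr
    refine (Complex.abs_re_le_norm _).trans ?_
    rw [norm_mul]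
    gcongr

theorem im_two_pi_mul (z : ℂ) : (2 * Real.pi * z).im = 2 * Real.pi * z.im := by
  rw [show (2 * Real.pi * z : ℂ) = ((2 * Real.pi : ℝ) : ℂ) * z by push_cast; ring,
    Complex.im_ofReal_mul]

/-- Bounds for `sin (2πy)` and for the derivative of the action when `x` has large imaginary
part. -/
theorem exists_bounds {ε : ℝ} (hε : 4 < ε) (lam : ℂ) (t : ℝ) : ∃ K X₀ : ℝ, 0 ≤ K ∧ 0 < X₀ ∧
    ∀ X ≥ X₀, ∀ y : ℂ, ((t : ℂ) + Complex.I * X, y) ∈ spectralCurve ε →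
      Real.exp (2 * Real.pi * X) / 5 ≤ ‖Complex.sin (2 * Real.pi * y)‖ ∧
      |(-(((t : ℂ) + Complex.I * X) * Complex.sin (2 * Real.pi * ((t : ℂ) + Complex.I * X)) + lam) /
        Complex.sin (2 * Real.pi * y)).re| ≤ |t| + K * Real.exp (-X) := by
  set K₁ : ℝ := ε + ε ^ 2 / 4 with hK₁
  have hK₁4 : 4 < K₁ := by nlinarith
  -- With `E = exp (2πX)`, `sin² (2πy)` differs from `sin² (2πx)` by at most `K₁ E`. For `E ≥ 18 K₁`
  -- this is at most `E² / 18`, half of the lower bound `E² / 9` for `|sin (2πx)|²`; then `1 / 18 ≥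
  -- 1 / 25` gives `E / 5`.
  refine ⟨(|t| + 1) * (18 * K₁) + 5 * ‖lam‖, 18 * K₁, by positivity, by positivity,
    fun X hX y hmem => ?_⟩
  set x : ℂ := (t : ℂ) + Complex.I * X with hx
  have hxim : x.im = X := by simp [hx]
  have hxre : x.re = t := by simp [hx]
  have hX0 : 0 < X := by linarith
  set E := Real.exp (2 * Real.pi * X) with hE
  have hE0 : 0 < E := Real.exp_pos _
  have hEX : X ≤ E := by
    have h1 := Real.add_one_le_exp (2 * Real.pi * X)
    nlinarith [Real.pi_gt_three]
  have hEK : 18 * K₁ ≤ E := hX.le.trans hEX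
  have hE72 : 72 ≤ E := by linarith
  have hEinv : Real.exp (-(2 * Real.pi * X)) ≤ 1 := Real.exp_le_one_iff.2 (by
    have := Real.pi_pos
    nlinarith)
  have hEinv0 := Real.exp_pos (-(2 * Real.pi * X))
  have him : (2 * Real.pi * x).im = 2 * Real.pi * X := by rw [im_two_pi_mul, hxim]
  set sx := Complex.sin (2 * Real.pi * x) with hsx
  set cx := Complex.cos (2 * Real.pi * x) with hcx
  set sy := Complex.sin (2 * Real.pi * y) with hsy
  have hsx1 : E / 3 ≤ ‖sx‖ := by
    have := sinh_le_norm_sin (2 * Real.pi * x)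
    rw [him, Real.sinh_eq] at this
    linarith
  have hcx1 : ‖cx‖ ≤ E := by
    have := norm_cos_le_cosh (2 * Real.pi * x)
    rw [him, Real.cosh_eq] at this
    linarith
  have hsq : sy ^ 2 = sx ^ 2 + (ε * cx - ε ^ 2 / 4) := by
    have h1 := sin_sq_eq_of_mem hmem
    have h2 := Complex.sin_sq_add_cos_sq (2 * Real.pi * x)
    rw [← hsx, ← hcx] at h2
    rw [← hsy, ← hcx] at h1
    rw [h1]
    linear_combination -h2
  have hrem : ‖(ε : ℂ) * cx - ε ^ 2 / 4‖ ≤ K₁ * E := by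
    refine (norm_sub_le _ _).trans ?_
    rw [norm_mul, norm_div, norm_pow, Complex.norm_real, Real.norm_eq_abs,
      abs_of_pos (by linarith : 0 < ε), show ‖(4 : ℂ)‖ = 4 by norm_num]
    have h1 : ε * ‖cx‖ ≤ ε * E := by gcongr
    have h2 : ε ^ 2 / 4 ≤ ε ^ 2 / 4 * E := le_mul_of_one_le_right (by positivity) (by linarith)
    rw [hK₁, add_mul]
    linarith
  have hsy1 : E ^ 2 / 18 ≤ ‖sy‖ ^ 2 := by
    have h1 := norm_sub_norm_le (sx ^ 2) (-((ε : ℂ) * cx - ε ^ 2 / 4))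
    rw [sub_neg_eq_add, ← hsq, norm_neg, norm_pow, norm_pow] at h1
    have h2 : (E / 3) ^ 2 ≤ ‖sx‖ ^ 2 := by gcongr
    nlinarith
  have hsy2 : E / 5 ≤ ‖sy‖ := by
    refine (pow_le_pow_iff_left₀ (by positivity) (norm_nonneg _) two_ne_zero).1 ?_
    nlinarith [sq_nonneg E]
  refine ⟨hsy2, ?_⟩
  have hsyn : 0 < ‖sy‖ := lt_of_lt_of_le (by positivity) hsy2
  have hsy0 : sy ≠ 0 := norm_pos_iff.1 hsyn
  have hq : ‖(sx / sy) ^ 2 - 1‖ ≤ 18 * K₁ / E := by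
    have h1 : (sx / sy) ^ 2 - 1 = -((ε : ℂ) * cx - ε ^ 2 / 4) / sy ^ 2 := by
      rw [div_pow, div_sub_one (pow_ne_zero 2 hsy0), hsq]
      ring_nf
    rw [h1, norm_div, norm_neg, norm_pow, div_le_div_iff₀ (by positivity) hE0]
    calc ‖(ε : ℂ) * cx - ε ^ 2 / 4‖ * E ≤ K₁ * E * E := by gcongr
      _ = 18 * K₁ * (E ^ 2 / 18) := by ring
      _ ≤ 18 * K₁ * ‖sy‖ ^ 2 := by gcongr
  have hxn : ‖x‖ ≤ |t| + X := by
    refine (Complex.norm_le_abs_re_add_abs_im x).trans ?_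
    rw [hxre, hxim, abs_of_pos hX0]
  have hsplit : -(x * sx + lam) / sy = -(x * (sx / sy) + lam / sy) := by
    field_simp
  have hlam : ‖lam / sy‖ ≤ 5 * ‖lam‖ / E := by
    rw [norm_div, div_le_div_iff₀ hsyn hE0]
    nlinarith [norm_nonneg lam]
  -- One factor `exp X` absorbs the linear growth of `|t| + X`; the other gives the decay `exp
  -- (-X)`.
  have hexp : Real.exp X * Real.exp X ≤ E := by
    rw [← Real.exp_add, hE]
    refine Real.exp_le_exp.2 ?_
    nlinarith [Real.pi_gt_three]
  have hexpX := Real.add_one_le_exp X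
  rw [hsplit, Complex.neg_re, abs_neg, Complex.add_re]
  calc |(x * (sx / sy)).re + (lam / sy).re|
      ≤ |(x * (sx / sy)).re| + |(lam / sy).re| := abs_add_le _ _
    _ ≤ (|x.re| + ‖x‖ * ‖(sx / sy) ^ 2 - 1‖) + ‖lam / sy‖ :=
        add_le_add (abs_re_mul_le _ _) (Complex.abs_re_le_norm _)
    _ ≤ (|t| + (|t| + X) * (18 * K₁ / E)) + 5 * ‖lam‖ / E := by
        rw [hxre]
        gcongr
    _ = |t| + ((|t| + X) * (18 * K₁) + 5 * ‖lam‖) / E := by ring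
    _ ≤ |t| + (((|t| + 1) * (18 * K₁) + 5 * ‖lam‖) * Real.exp X) / (Real.exp X * Real.exp X) := by
        gcongr
        have h1 : |t| + X ≤ (|t| + 1) * Real.exp X := by nlinarith [abs_nonneg t]
        have h2 : 5 * ‖lam‖ ≤ 5 * ‖lam‖ * Real.exp X :=
          le_mul_of_one_le_right (by positivity) (by linarith)
        nlinarith
    _ = |t| + ((|t| + 1) * (18 * K₁) + 5 * ‖lam‖) * Real.exp (-X) := by
        rw [Real.exp_neg]
        field_simp

/-- Exponential growth of the imaginary part of the action. -/
theorem exists_cosh_im_le {lam : ℂ} {ε : ℝ} (hε : 4 < ε)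
    (hspec : SpectralEquations lam ε (basePoint ε)) (t : ℝ) :
    ∃ C X₀ : ℝ, 0 ≤ C ∧ ∀ X ≥ X₀, ∀ y w : ℂ, IsAction lam ε ((t : ℂ) + Complex.I * X) y w →
      Real.cosh (4 * Real.pi * w.im) ≤ C * Real.exp (4 * Real.pi * |t| * X) := by
  -- `cosh` is even and smooth, and `Im w` ignores integer shifts, so this measure of `|Im w|` is a
  -- differentiable function along the line, without a choice of branch for `w`.
  obtain ⟨N, hN⟩ := exists_descend hε hspec (fun _ w => Real.cosh (4 * Real.pi * w.im))
    (fun y w k n => by simp) (fun y w => by simp)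
  obtain ⟨K, X₀, hK, hX₀, hb⟩ := exists_bounds hε lam t
  -- Integrating factor for `N' ≤ 4π(|t| + K exp (-X)) N`: the exponent is minus a primitive of the
  -- coefficient, so `N * e` is nonincreasing.
  let e : ℝ → ℝ := fun X => Real.exp (-(4 * Real.pi * (|t| * X - K * Real.exp (-X))))
  let M : ℝ → ℝ := fun X => N ((t : ℂ) + Complex.I * X) * e X
  have he : ∀ X, HasDerivAt e (-(4 * Real.pi * (|t| + K * Real.exp (-X))) * e X) X := fun X => by
    have h1 : HasDerivAt (fun X : ℝ => Real.exp (-X)) (-Real.exp (-X)) X := by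
      simpa using (hasDerivAt_neg X).exp
    have h2 := (((((hasDerivAt_id X).const_mul |t|).sub (h1.const_mul K)).const_mul
      (4 * Real.pi)).neg).exp
    refine h2.congr_deriv ?_
    simp only [e, Pi.neg_apply, Pi.sub_apply, id]
    ring
  have hM : ∀ X ≥ X₀, ∃ M' ≤ 0, HasDerivAt M M' X := by
    intro X hX
    obtain ⟨y, hy⟩ := exists_mem_spectralCurve ε ((t : ℂ) + Complex.I * X)
    obtain ⟨w, hw⟩ := exists_isAction hε hspec hy
    obtain ⟨hb1, hb2⟩ := hb X hX y hy
    have hs : Complex.sin (2 * Real.pi * y) ≠ 0 :=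
      norm_pos_iff.1 (lt_of_lt_of_le (by positivity) hb1)
    obtain ⟨r, hr, Y, G, hY0, hG0, hYd, hY⟩ := exists_chart_fst hε lam hy hs
    obtain ⟨-, -, hGd, -⟩ := hY _ (Metric.mem_ball_self hr)
    rw [hY0] at hGd
    set G' := -(((t : ℂ) + Complex.I * X) *
      Complex.sin (2 * Real.pi * ((t : ℂ) + Complex.I * X)) + lam) / Complex.sin (2 * Real.pi * y)
    have hl : HasDerivAt (fun X : ℝ => (t : ℂ) + Complex.I * X) Complex.I X := by
      simpa using ((Complex.ofRealCLM.hasDerivAt (x := X)).const_mul Complex.I).const_add (t : ℂ)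
    have h1 : HasDerivAt (fun X : ℝ => w + G ((t : ℂ) + Complex.I * X)) (G' * Complex.I) X :=
      (hGd.comp X hl).const_add w
    have h2 : HasDerivAt (fun X : ℝ => (w + G ((t : ℂ) + Complex.I * X)).im) G'.re X := by
      have := (Complex.imCLM.hasFDerivAt (x := w + G ((t : ℂ) + Complex.I * X))).comp_hasDerivAt X h1
      simpa [Function.comp_def] using this
    have h3 := (h2.const_mul (4 * Real.pi)).cosh
    have h4 : HasDerivAt (fun X : ℝ => N ((t : ℂ) + Complex.I * X))
        (Real.sinh (4 * Real.pi * (w + G ((t : ℂ) + Complex.I * X)).im) * (4 * Real.pi * G'.re)) X := by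
      refine h3.congr_of_eventuallyEq ?_
      filter_upwards [hl.continuousAt.preimage_mem_nhds (Metric.ball_mem_nhds _ hr)] with u hu
      exact hN _ _ _ (hw.trans hε (hY _ hu).2.2.2)
    rw [hG0, add_zero] at h4
    refine ⟨_, ?_, h4.mul (he X)⟩
    rw [hN _ _ _ hw]
    have hsc : |Real.sinh (4 * Real.pi * w.im)| ≤ Real.cosh (4 * Real.pi * w.im) := by
      rw [abs_le]
      constructor
      · have := Real.sinh_lt_cosh (-(4 * Real.pi * w.im))
        rw [Real.sinh_neg, Real.cosh_neg] at this
        linarith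
      · exact (Real.sinh_lt_cosh _).le
    have h5 : Real.sinh (4 * Real.pi * w.im) * G'.re ≤
        Real.cosh (4 * Real.pi * w.im) * (|t| + K * Real.exp (-X)) := by
      refine (le_abs_self _).trans ?_
      rw [abs_mul]
      gcongr
    have h6 : 0 < e X := Real.exp_pos _
    have h7 : 0 ≤ 4 * Real.pi * e X := by positivity
    nlinarith [mul_le_mul_of_nonneg_left h5 h7]
  have hanti : AntitoneOn M (Ici X₀) := by
    refine antitoneOn_of_deriv_nonpos (convex_Ici _) ?_ ?_ ?_
    · intro X hX
      obtain ⟨M', -, h⟩ := hM X hX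
      exact h.continuousAt.continuousWithinAt
    · intro X hX
      obtain ⟨M', -, h⟩ := hM X (interior_subset hX)
      exact h.differentiableAt.differentiableWithinAt
    · intro X hX
      obtain ⟨M', h0, h⟩ := hM X (interior_subset hX)
      rwa [h.deriv]
  obtain ⟨y₀, hy₀⟩ := exists_mem_spectralCurve ε ((t : ℂ) + Complex.I * X₀)
  obtain ⟨w₀, hw₀⟩ := exists_isAction hε hspec hy₀
  have hM0 : 0 ≤ M X₀ := mul_nonneg (by rw [hN _ _ _ hw₀]; exact (Real.cosh_pos _).le)
    (Real.exp_pos _).le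
  refine ⟨M X₀, X₀, hM0, fun X hX y w hw => ?_⟩
  have h1 : M X ≤ M X₀ := hanti self_mem_Ici hX hX
  have h2 : Real.cosh (4 * Real.pi * w.im) =
      M X * Real.exp (4 * Real.pi * (|t| * X - K * Real.exp (-X))) := by
    simp only [M, e]
    rw [mul_assoc (N _), ← Real.exp_add, neg_add_cancel, Real.exp_zero, mul_one, hN _ _ _ hw]
  rw [h2]
  refine mul_le_mul h1 (Real.exp_le_exp.2 ?_) (Real.exp_pos _).le hM0
  have h3 : 0 ≤ 4 * Real.pi * (K * Real.exp (-X)) := by positivity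
  nlinarith

/-! ### Decay of the entire solution and square integrability -/

theorem IsSinQuotient.exists_decay {lam : ℂ} {ε : ℝ} (hε : 4 < ε)
    (hspec : SpectralEquations lam ε (basePoint ε)) {f : ℂ → ℂ} (hf : IsSinQuotient lam ε f)
    (t : ℝ) : ∃ C X₀ : ℝ, ∀ X ≥ X₀,
      ‖entireExtension f ((t : ℂ) + Complex.I * X)‖ ^ 2 ≤
        C * Real.exp (-(4 * Real.pi * (1 - |t|)) * X) ∧
      ‖entireExtension f (-((t : ℂ) + Complex.I * X))‖ ^ 2 ≤
        C * Real.exp (-(4 * Real.pi * (1 - |t|)) * X) := by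
  obtain ⟨C, X₁, hC, h1⟩ := exists_cosh_im_le hε hspec t
  obtain ⟨K, X₂, hK, hX₂, hb⟩ := exists_bounds hε lam t
  -- `25` comes from the bound `exp (2πX) / 5` for the denominator.
  refine ⟨25 * C, max X₁ X₂, fun X hX => ?_⟩
  obtain ⟨y, hy⟩ := exists_mem_spectralCurve ε ((t : ℂ) + Complex.I * X)
  obtain ⟨w, hw⟩ := exists_isAction hε hspec hy
  have h2 := h1 X ((le_max_left _ _).trans hX) y w hw
  have h3 := (hb X ((le_max_right _ _).trans hX) y hy).1
  have hE := Real.exp_pos (2 * Real.pi * X)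
  have hs : Complex.sin (2 * Real.pi * y) ≠ 0 :=
    norm_pos_iff.1 (lt_of_lt_of_le (by positivity) h3)
  obtain ⟨κ, -, hneg⟩ := IsAction.exists_neg_fst hε hspec
  rw [entireExtension_eq (hf.differentiableAt hε hw hs).continuousAt,
    entireExtension_eq (hf.differentiableAt hε (hneg _ _ _ hw) hs).continuousAt,
    hf.norm_neg hε hspec, and_self, hf _ _ _ hw, norm_div, div_pow,
    div_le_iff₀ (by positivity)]
  have h4 : ‖Complex.sin (2 * Real.pi * w)‖ ^ 2 ≤ Real.cosh (4 * Real.pi * w.im) := by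
    have h5 := norm_sin_le_cosh (2 * Real.pi * w)
    rw [im_two_pi_mul] at h5
    rw [show 4 * Real.pi * w.im = 2 * (2 * Real.pi * w.im) by ring, Real.cosh_two_mul]
    have := pow_le_pow_left₀ (norm_nonneg _) h5 2
    nlinarith [sq_nonneg (Real.sinh (2 * Real.pi * w.im))]
  calc ‖Complex.sin (2 * Real.pi * w)‖ ^ 2 ≤ C * Real.exp (4 * Real.pi * |t| * X) := h4.trans h2
    _ = 25 * C * Real.exp (-(4 * Real.pi * (1 - |t|)) * X) *
        (Real.exp (2 * Real.pi * X) / 5) ^ 2 := by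
        rw [div_pow, ← Real.exp_nat_mul]
        have : Real.exp (4 * Real.pi * |t| * X) = Real.exp (-(4 * Real.pi * (1 - |t|)) * X) *
            Real.exp ((2 : ℕ) * (2 * Real.pi * X)) := by
          rw [← Real.exp_add]
          congr 1
          push_cast
          ring
        rw [this]
        ring
    _ ≤ _ := by gcongr

theorem integrable_of_exp_decay {h : ℝ → ℝ} (hc : Continuous h) (h0 : ∀ x, 0 ≤ h x) {b C X₀ : ℝ}
    (hb : 0 < b) (h1 : ∀ X ≥ X₀, h X ≤ C * Real.exp (-b * X) ∧ h (-X) ≤ C * Real.exp (-b * X)) :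
    Integrable h := by
  have key : ∀ g : ℝ → ℝ, Continuous g → (∀ x, 0 ≤ g x) →
      (∀ X ≥ X₀, g X ≤ C * Real.exp (-b * X)) → IntegrableOn g (Ioi 0) := by
    intro g hgc hg0 hg
    refine integrable_of_isBigO_exp_neg hb hgc.continuousOn (Asymptotics.IsBigO.of_bound C ?_)
    filter_upwards [eventually_ge_atTop X₀] with X hX
    rw [Real.norm_of_nonneg (hg0 X), Real.norm_of_nonneg (Real.exp_pos _).le]
    exact hg X hX
  have hp := key h hc h0 fun X hX => (h1 X hX).1
  have hn := key (fun x => h (-x)) (by fun_prop) (fun x => h0 _) fun X hX => (h1 X hX).2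
  have hn' : IntegrableOn h (Iic 0) := by
    rw [integrableOn_Iic_iff_integrableOn_Iio]
    have := (MeasurePreserving.integrableOn_comp_preimage
      (Measure.measurePreserving_neg (volume : Measure ℝ))
      (Homeomorph.neg ℝ).measurableEmbedding (f := h) (s := Iio 0)).1
    refine this ?_
    simpa [Function.comp_def] using hn
  rw [← integrableOn_univ, ← Iic_union_Ioi (a := (0 : ℝ))]
  exact hn'.union hp

theorem IsSinQuotient.isEigenfunction {lam : ℂ} {ε : ℝ} (hε : 4 < ε)
    (hspec : SpectralEquations lam ε (basePoint ε)) {f : ℂ → ℂ} (hf : IsSinQuotient lam ε f) :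
    IsEigenfunction ε (fun z => entireExtension f (Complex.I * z)) where
  diffContOnCl := ((hf.differentiable hε hspec).comp (by fun_prop)).diffContOnCl
  memLp := fun t ht => by
    have hφ := (hf.differentiable hε hspec).continuous
    have hc : Continuous fun x : ℝ => entireExtension f (Complex.I * (x + t * Complex.I)) :=
      hφ.comp (by fun_prop)
    rw [memLp_two_iff_integrable_sq_norm hc.aestronglyMeasurable]
    -- `i(X + it) = -t + iX` and `i(-X + it) = -(t + iX)`, so the two ends of the line use the decay
    -- estimates for `-t` and for `t`.
    obtain ⟨C, X₀, h1⟩ := hf.exists_decay hε hspec (-t)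
    obtain ⟨C', X₀', h2⟩ := hf.exists_decay hε hspec t
    rw [abs_neg] at h1
    refine integrable_of_exp_decay (b := 4 * Real.pi * (1 - |t|)) (C := max C C')
      (X₀ := max X₀ X₀') (hc.norm.pow 2) (fun x => by positivity)
      (mul_pos (by positivity) (by linarith)) fun X hX => ⟨?_, ?_⟩
    · have h3 := (h1 X ((le_max_left _ _).trans hX)).1
      rw [show Complex.I * ((X : ℂ) + t * Complex.I) = ((-t : ℝ) : ℂ) + Complex.I * X by
        push_cast
        linear_combination (t : ℂ) * Complex.I_sq]
      refine h3.trans ?_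
      gcongr
      exact le_max_left _ _
    · have h3 := (h2 X ((le_max_right _ _).trans hX)).2
      rw [show Complex.I * (((-X : ℝ) : ℂ) + t * Complex.I) = -((t : ℂ) + Complex.I * X) by
        push_cast
        linear_combination (t : ℂ) * Complex.I_sq]
      refine h3.trans ?_
      gcongr
      exact le_max_right _ _
  ne_zero := hf.exists_ne_zero hε hspec
  equation := fun x => by
    have h := hf.difference_equation hε hspec (Complex.I * x)
    have hcos : Complex.cos (2 * Real.pi * (Complex.I * x)) = Complex.cosh (2 * Real.pi * x) := by
      rw [cos_two_pi_I, Complex.ofReal_cosh]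
      push_cast
      rfl
    rw [hcos] at h
    rw [show Complex.I * ((x : ℂ) - Complex.I) = Complex.I * x + 1 by
        linear_combination -Complex.I_sq,
      show Complex.I * ((x : ℂ) + Complex.I) = Complex.I * x - 1 by
        linear_combination Complex.I_sq]
    linear_combination h

end Harper

theorem mainTheorem7 (lam : ℂ) (ε : ℝ) (hε : 4 < ε)
    (hspec : Harper.SpectralEquations lam ε (Harper.basePoint ε)) :
    (∃ φ : ℂ → ℂ, Differentiable ℂ φ ∧
      (∀ x y : ℂ, (x, y) ∈ Harper.spectralCurve ε →
        ∀ γ : Path (Harper.basePoint ε) (x, y), Harper.IsCurvePath ε γ →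
          Complex.sin (2 * Real.pi * y) * φ x =
            Complex.sin (2 * Real.pi * curveIntegral (Harper.theta lam) γ)) ∧
      (∀ x : ℂ, φ (x - 1) + φ (x + 1) +
        (2 * Complex.cos (2 * Real.pi * x) - ε) * φ x = 0) ∧
      Harper.IsEigenfunction ε (fun z => φ (Complex.I * z))) ∧
    (∃ n : ℕ, Harper.perA ε * lam - Harper.perAtilde ε = (n : ℂ) + 1 ∧
      Harper.perA ε * Harper.perBtilde ε - Harper.perB ε * Harper.perAtilde ε =
        ((n : ℝ) + 1) * Harper.perB ε) ∧
    (∃ m : ℤ, Complex.I * (Harper.perBtilde ε - lam * Harper.perB ε) = (m : ℂ)) ∧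
    lam = (Harper.perBtilde ε : ℂ) / Harper.perB ε := by
  obtain ⟨f, hf⟩ := Harper.exists_isSinQuotient hε hspec
  exact ⟨⟨Harper.entireExtension f, hf.differentiable hε hspec,
    fun x y _ γ hγ => hf.sin_mul hε hspec ⟨γ, hγ, rfl⟩, hf.difference_equation hε hspec,
    hf.isEigenfunction hε hspec⟩, hspec.exists_quantum_number hε, hspec.exists_perB_eq hε,
    hspec.eq_div hε⟩
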